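/- Let $\mathcal D$ be a finite set. Let $\mathcal T$ be the set of planar rooted trees whose vertices are decorated by elements of $\mathcal D$, with edges oriented away from the root, and let $\mathcal H=\mathcal H^{\mathcal D}_{P,R}$ be the free (noncommutative) unital associative $\mathbb Q$-algebra generated by $\mathcal T$. Its monomials $t_1\cdots t_n$ are the planar forests (with $1$ the empty forest), and they form a basis of $\mathcal H$. The algebra $\mathcal H$ is a Hopf algebra for the algebra morphism $\Delta:\mathcal H\to\mathcal H\otimes\mathcal H$ given on trees by $$\Delta(t)=t\otimes 1+1\otimes t+\sum_{c} P^c(t)\otimes R^c(t),$$ where $c$ runs over the admissible cuts of $t$ (nonempty sets of edges such that every oriented path meets at most one of them), $R^c(t)$ is the component of the root after the cut and $P^c(t)$ is the planar forest formed by the other components; its counit $\varepsilon$ maps every nonempty forest to $0$. It is graded by the weight, i.e. the number of vertices: $\mathcal H_n$ is the span of the forests with $n$ vertices, which is finite dimensional. Let $\mathcal H^{*g}=\{f\in\mathcal H^*:\exists n_0\ \forall n\ge n_0,\ f(\mathcal H_n)=0\}$ be the graded dual, with grading $(\mathcal H^{*g})_n=\{f\in\mathcal H^{*}: f(\mathcal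 H_k)=0 \text{ for all } k\neq n\}$ and with the Hopf algebra structure $(fg)(x)=(f\otimes g)(\Delta(x))$, $1_{\mathcal H^{*g}}=\varepsilon$, $\Delta(f)(x\otimes y)=f(xy)$, $\varepsilon(f)=f(1)$, $S(f)=f\circ S$. For $d\in\mathcal D$, let $B_d^+:\mathcal H\to\mathcal H$ be the linear map sending a forest $t_1\cdots t_n$ to the tree obtained by grafting $t_1,\dots,t_n$, in this order, on a common root decorated by $d$. Let $\gamma_d:\mathcal H\to\mathcal H$ be the linear map with $\gamma_d(1)=0$ and, for $n\geq 1$, $\gamma_d(t_1\cdots t_n)=t_1\cdots t_{n-1}$ if $t_n=\bullet_d$ is the single vertex decorated by $d$, and $\gamma_d(t_1\cdots t_n)=0$ otherwise. Let $\gamma_d^{*g}:\mathcal H^{*g}\to\mathcal H^{*g}$, $f\mapsto f\circ\gamma_d$, be its transpose. Then there is a unique bialgebra morphism $\Psi:\mathcal H\to\mathcal H^{*g}$ such that $\Psi\circ B_d^+=\gamma_d^{*g}\circ\Psi$ for all $d\in\mathcal D$, and $\Psi$ is an isomorphism of graded Hopf algebras: it is bijective, it is compatible with products, units, coproducts, counits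 and antipodes, and $\Psi(\mathcal H_n)=(\mathcal H^{*g})_n$ for all $n$. In particular $\mathcal H^{\mathcal D}_{P,R}$ is isomorphic, as a graded Hopf algebra, to its own graded dual. -/

import Mathlib

open scoped TensorProduct

section GradedDual

open Coalgebra HopfAlgebra WithConv

variable {K A : Type*} [Field K] [Ring A]

/-- The grading of `A ⊗ A`: the component of weight `n` is `∑_{k+l=n} A_k ⊗ A_l`. -/
def tensorGrading [Algebra K A] (𝒜 : ℕ → Submodule K A) (n : ℕ) : Submodule K (A ⊗[K] A) :=
  Submodule.span K {z | ∃ k l a b, k + l = n ∧ a ∈ 𝒜 k ∧ b ∈ 𝒜 l ∧ z = a ⊗ₜ[K] b}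

/-- A graded Hopf algebra with finite dimensional homogeneous components: a graded algebra whose
coproduct, counit and antipode are homogeneous of degree `0`. -/
class IsGradedHopfAlgebra [HopfAlgebra K A] (𝒜 : ℕ → Submodule K A) [GradedAlgebra 𝒜] :
    Prop where
  comul_mem : ∀ n, ∀ x ∈ 𝒜 n, comul (R := K) x ∈ tensorGrading 𝒜 n
  counit_eq_zero : ∀ n, n ≠ 0 → ∀ x ∈ 𝒜 n, counit (R := K) x = 0
  antipode_mem : ∀ n, ∀ x ∈ 𝒜 n, antipode K x ∈ 𝒜 n
  finite : ∀ n, FiniteDimensional K (𝒜 n)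

section Antipode

variable [Bialgebra K A] (𝒜 : ℕ → Submodule K A)

theorem conv_congr {B : Type*} [Ring B] [Algebra K B] {n : ℕ}
    (f g f' g' : WithConv (A →ₗ[K] B)) {x : A} (hx : comul (R := K) x ∈ tensorGrading 𝒜 n)
    (h : ∀ k l a b, k + l = n → a ∈ 𝒜 k → b ∈ 𝒜 l →
      f.ofConv a * g.ofConv b = f'.ofConv a * g'.ofConv b) :
    (f * g).ofConv x = (f' * g').ofConv x := by
  change LinearMap.mul' K B (TensorProduct.map f.ofConv g.ofConv (comul x)) =
    LinearMap.mul' K B (TensorProduct.map f'.ofConv g'.ofConv (comul x))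
  generalize comul (R := K) x = y at hx
  induction hx using Submodule.span_induction with
  | mem z hz =>
    obtain ⟨k, l, a, b, hkl, ha, hb, rfl⟩ := hz
    simpa using h k l a b hkl ha hb
  | zero => simp
  | add z w _ _ hz hw => simp only [map_add, hz, hw]
  | smul r z _ hz => simp only [map_smul, hz]

theorem conv_mem {n : ℕ} (f g : WithConv (A →ₗ[K] A)) [SetLike.GradedMonoid 𝒜]
    {x : A} (hx : comul (R := K) x ∈ tensorGrading 𝒜 n)
    (hf : ∀ k, ∀ a ∈ 𝒜 k, f.ofConv a ∈ 𝒜 k) (hg : ∀ k, ∀ a ∈ 𝒜 k, g.ofConv a ∈ 𝒜 k) :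
    (f * g).ofConv x ∈ 𝒜 n := by
  change LinearMap.mul' K A (TensorProduct.map f.ofConv g.ofConv (comul x)) ∈ _
  generalize comul (R := K) x = y at hx
  induction hx using Submodule.span_induction with
  | mem z hz =>
    obtain ⟨k, l, a, b, rfl, ha, hb, rfl⟩ := hz
    simpa using SetLike.mul_mem_graded (hf k a ha) (hg l b hb)
  | zero => simp
  | add z w _ _ hz hw => simpa only [map_add] using add_mem hz hw
  | smul r z _ hz => simpa only [map_smul] using Submodule.smul_mem _ r hz

/-- `η ∘ ε - id`, as an element of the convolution algebra. -/
noncomputable def convNil (K A : Type*) [Field K] [Ring A] [Bialgebra K A] :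
    WithConv (A →ₗ[K] A) :=
  1 - toConv LinearMap.id

theorem convNil_apply (x : A) :
    (convNil K A).ofConv x = algebraMap K A (counit (R := K) x) - x := rfl

theorem convNil_pow_apply {𝒜 : ℕ → Submodule K A}
    (hΔ : ∀ n, ∀ x ∈ 𝒜 n, comul (R := K) x ∈ tensorGrading 𝒜 n)
    (h0 : ∀ x ∈ 𝒜 0, algebraMap K A (counit (R := K) x) = x)
    (n : ℕ) : ∀ m < n, ∀ x ∈ 𝒜 m, (convNil K A ^ n).ofConv x = 0 := by
  induction n with
  | zero => simp
  | succ n ih =>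
    intro m hm x hx
    rw [pow_succ', conv_congr 𝒜 _ _ 0 0 (hΔ m x hx)]
    · simp
    · intro k l a b hkl ha hb
      rcases Nat.eq_zero_or_pos k with rfl | hk
      · rw [convNil_apply, h0 a ha]
        simp
      · rw [ih l (by omega) b hb]
        simp

variable [GradedAlgebra 𝒜]

/-- The geometric series `∑ (η ∘ ε - id)^n`, which is a finite sum on each homogeneous component
of a connected graded bialgebra. -/
noncomputable def convInverse : A →ₗ[K] A :=
  DirectSum.toModule K ℕ A (fun i =>
    (∑ n ∈ Finset.range (i + 1), convNil K A ^ n).ofConv ∘ₗ (𝒜 i).subtype) ∘ₗ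
    (DirectSum.decomposeLinearEquiv 𝒜).toLinearMap

variable {𝒜}

theorem convInverse_apply {i : ℕ} {x : A} (hx : x ∈ 𝒜 i) : convInverse 𝒜 x =
    (∑ n ∈ Finset.range (i + 1), convNil K A ^ n).ofConv x := by
  simp only [convInverse, LinearMap.comp_apply, LinearEquiv.coe_coe,
    DirectSum.decomposeLinearEquiv_apply, DirectSum.decompose_of_mem 𝒜 hx]
  exact DirectSum.toModule_lof K (M := fun i => 𝒜 i) i ⟨x, hx⟩

theorem convInverse_apply_of_le
    (hΔ : ∀ n, ∀ x ∈ 𝒜 n, comul (R := K) x ∈ tensorGrading 𝒜 n)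
    (h0 : ∀ x ∈ 𝒜 0, algebraMap K A (counit (R := K) x) = x)
    {i N : ℕ} (hi : i ≤ N) {x : A} (hx : x ∈ 𝒜 i) :
    convInverse 𝒜 x = (∑ n ∈ Finset.range (N + 1), convNil K A ^ n).ofConv x := by
  rw [convInverse_apply hx]
  simp only [ofConv_sum, LinearMap.sum_apply]
  refine Finset.sum_subset (by simpa using hi) fun n _ hn => ?_
  exact convNil_pow_apply hΔ h0 n i (by simpa using hn) x hx

theorem linearMap_ext_graded {B : Type*} [AddCommGroup B] [Module K B] {f g : A →ₗ[K] B}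
    (h : ∀ n, ∀ x ∈ 𝒜 n, f x = g x) : f = g := by
  ext x
  induction x using DirectSum.Decomposition.inductionOn 𝒜 with
  | zero => simp
  | homogeneous m => exact h _ _ m.2
  | add x y hx hy => rw [map_add, map_add, hx, hy]

theorem convInverse_mul
    (hΔ : ∀ n, ∀ x ∈ 𝒜 n, comul (R := K) x ∈ tensorGrading 𝒜 n)
    (h0 : ∀ x ∈ 𝒜 0, algebraMap K A (counit (R := K) x) = x) :
    toConv (convInverse 𝒜) * toConv LinearMap.id = 1 := by
  refine WithConv.ext (linearMap_ext_graded (𝒜 := 𝒜) fun m x hx => ?_)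
  rw [conv_congr 𝒜 _ _ (∑ n ∈ Finset.range (m + 1), convNil K A ^ n) (1 - convNil K A) (hΔ m x hx),
    geom_sum_mul_neg]
  · have := convNil_pow_apply hΔ h0 (m + 1) m (by omega) x hx
    simp [this]
  · intro k l a b hkl ha hb
    rw [ofConv_toConv, convInverse_apply_of_le hΔ h0 (show k ≤ m by omega) ha]
    simp [convNil]

theorem mul_convInverse
    (hΔ : ∀ n, ∀ x ∈ 𝒜 n, comul (R := K) x ∈ tensorGrading 𝒜 n)
    (h0 : ∀ x ∈ 𝒜 0, algebraMap K A (counit (R := K) x) = x) :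
    toConv LinearMap.id * toConv (convInverse 𝒜) = 1 := by
  refine WithConv.ext (linearMap_ext_graded (𝒜 := 𝒜) fun m x hx => ?_)
  rw [conv_congr 𝒜 _ _ (1 - convNil K A) (∑ n ∈ Finset.range (m + 1), convNil K A ^ n) (hΔ m x hx),
    mul_neg_geom_sum]
  · have := convNil_pow_apply hΔ h0 (m + 1) m (by omega) x hx
    simp [this]
  · intro k l a b hkl ha hb
    rw [ofConv_toConv, ofConv_toConv, convInverse_apply_of_le hΔ h0 (show l ≤ m by omega) hb]
    simp [convNil]

theorem convInverse_mem
    (hΔ : ∀ n, ∀ x ∈ 𝒜 n, comul (R := K) x ∈ tensorGrading 𝒜 n)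
    (hε : ∀ n, n ≠ 0 → ∀ x ∈ 𝒜 n, counit (R := K) x = 0)
    (n : ℕ) (x : A)
    (hx : x ∈ 𝒜 n) : convInverse 𝒜 x ∈ 𝒜 n := by
  have hone : ∀ k, ∀ a ∈ 𝒜 k, algebraMap K A (counit (R := K) a) ∈ 𝒜 k := by
    intro k a ha
    rcases eq_or_ne k 0 with rfl | hk
    · exact SetLike.algebraMap_mem_graded 𝒜 _
    · simp [hε k hk a ha]
  have hpow : ∀ m k, ∀ a ∈ 𝒜 k, (convNil K A ^ m).ofConv a ∈ 𝒜 k := by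
    intro m
    induction m with
    | zero => simpa using hone
    | succ m ih =>
      intro k a ha
      rw [pow_succ']
      exact conv_mem 𝒜 _ _ (hΔ k a ha) (fun k a ha => sub_mem (hone k a ha) ha) ih
  rw [convInverse_apply hx, ofConv_sum, LinearMap.sum_apply]
  exact sum_mem fun m _ => hpow m n x hx

end Antipode

section Dual

variable [HopfAlgebra K A] (𝒜 : ℕ → Submodule K A) [GradedAlgebra 𝒜] [IsGradedHopfAlgebra 𝒜]

/-- The graded dual `A^{*g}`: the linear forms that vanish on `A_n` for all large `n`. It is a
subalgebra of the convolution algebra of linear forms, so that `(fg)(x) = (f ⊗ g)(Δ(x))` and the unit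
is the counit of `A`. -/
def gradedDualSubalgebra : Subalgebra K (WithConv (A →ₗ[K] K)) where
  carrier := {f | ∃ n₀, ∀ n ≥ n₀, ∀ x ∈ 𝒜 n, f.ofConv x = 0}
  add_mem' := by
    rintro f g ⟨m, hf⟩ ⟨n, hg⟩
    refine ⟨max m n, fun k hk x hx => ?_⟩
    rw [ofConv_add, LinearMap.add_apply, hf k (le_of_max_le_left hk) x hx,
      hg k (le_of_max_le_right hk) x hx, add_zero]
  mul_mem' := by
    rintro f g ⟨m, hf⟩ ⟨n, hg⟩
    refine ⟨m + n, fun k hk x hx => ?_⟩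
    rw [conv_congr 𝒜 f g 0 0 (IsGradedHopfAlgebra.comul_mem k x hx)]
    · simp
    · intro i j a b hij ha hb
      by_cases hi : m ≤ i
      · simp [hf i hi a ha]
      · simp [hg j (by omega) b hb]
  algebraMap_mem' r := ⟨1, fun n hn x hx => by
    have := IsGradedHopfAlgebra.counit_eq_zero (K := K) (𝒜 := 𝒜) n (by omega) x hx
    simp [this]⟩

/-- The graded dual of a graded Hopf algebra, as a type. -/
def GradedDual : Type _ := gradedDualSubalgebra 𝒜

namespace GradedDual

variable {𝒜}

noncomputable instance : Ring (GradedDual 𝒜) := inferInstanceAs (Ring (gradedDualSubalgebra 𝒜))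

noncomputable instance : Algebra K (GradedDual 𝒜) :=
  inferInstanceAs (Algebra K (gradedDualSubalgebra 𝒜))

/-- The inclusion of the graded dual into the full dual. -/
def toDual : GradedDual 𝒜 →ₗ[K] Module.Dual K A where
  toFun f := f.1.ofConv
  map_add' _ _ := rfl
  map_smul' _ _ := rfl

theorem toDual_injective : Function.Injective (toDual (𝒜 := 𝒜)) := fun _ _ h =>
  Subtype.ext (WithConv.ext h)

theorem toDual_mul (f g : GradedDual 𝒜) (x : A) : toDual (f * g) x =
    LinearMap.mul' K K (TensorProduct.map (toDual f) (toDual g) (comul (R := K) x)) := rfl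

theorem toDual_one (x : A) : toDual (1 : GradedDual 𝒜) x = counit (R := K) x := rfl

/-- A linear form that vanishes on all components of large weight, as an element of the graded dual. -/
def ofDual (f : Module.Dual K A) (hf : ∃ n₀, ∀ n ≥ n₀, ∀ x ∈ 𝒜 n, f x = 0) : GradedDual 𝒜 :=
  ⟨toConv f, hf⟩

@[simp] theorem toDual_ofDual (f : Module.Dual K A) (hf : ∃ n₀, ∀ n ≥ n₀, ∀ x ∈ 𝒜 n, f x = 0) :
    toDual (ofDual f hf) = f := rfl

theorem exists_toDual (f : GradedDual 𝒜) : ∃ n₀, ∀ n ≥ n₀, ∀ x ∈ 𝒜 n, toDual f x = 0 := f.2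

variable (𝒜) in
/-- The homogeneous component of weight `n` of the graded dual: the linear forms that vanish on
`A_k` for all `k ≠ n`. -/
def grading (n : ℕ) : Submodule K (GradedDual 𝒜) where
  carrier := {f | ∀ k, k ≠ n → ∀ x ∈ 𝒜 k, toDual f x = 0}
  add_mem' hf hg k hk x hx := by
    rw [map_add, LinearMap.add_apply, hf k hk x hx, hg k hk x hx, add_zero]
  zero_mem' k hk x hx := by simp
  smul_mem' r f hf k hk x hx := by rw [map_smul, LinearMap.smul_apply, hf k hk x hx, smul_zero]

theorem dualDistrib_injective {M N V W : Type*} [AddCommGroup M] [Module K M] [AddCommGroup N]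
    [Module K N] [AddCommGroup V] [Module K V] [AddCommGroup W] [Module K W]
    {i : M →ₗ[K] Module.Dual K V} {j : N →ₗ[K] Module.Dual K W}
    (hi : Function.Injective i) (hj : Function.Injective j) :
    Function.Injective (TensorProduct.dualDistrib K V W ∘ₗ TensorProduct.map i j) := by
  rw [← LinearMap.ker_eq_bot, LinearMap.ker_eq_bot']
  classical
  intro z hz
  let b := Module.Basis.ofVectorSpace K N
  obtain ⟨c, rfl⟩ := (TensorProduct.equivFinsuppOfBasisRight (M := M) b).symm.surjective z
  rw [TensorProduct.equivFinsuppOfBasisRight_symm_apply] at hz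
  have h : ∀ x k, i (c k) x = 0 := by
    intro x
    have h1 : Finsupp.linearCombination K b (c.mapRange (fun m => i m x) (by simp)) = 0 := by
      apply hj
      ext y
      have := LinearMap.congr_fun hz (x ⊗ₜ y)
      rw [Finsupp.linearCombination_apply, Finsupp.sum_mapRange_index (by simp)]
      simpa [Finsupp.sum, map_sum, LinearMap.sum_apply] using this
    have h2 := (linearIndependent_iff.1 b.linearIndependent) _ h1
    intro k
    simpa using DFunLike.congr_fun h2 k
  have : c = 0 := by
    ext k
    exact hi (by rw [Finsupp.zero_apply, map_zero]; exact LinearMap.ext fun x => h x k)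
  rw [this, map_zero]

variable (𝒜) in
/-- `θ(f ⊗ g)(x ⊗ y) = f(x) g(y)`. -/
noncomputable def theta : GradedDual 𝒜 ⊗[K] GradedDual 𝒜 →ₗ[K] Module.Dual K (A ⊗[K] A) :=
  TensorProduct.dualDistrib K A A ∘ₗ TensorProduct.map toDual toDual

@[simp] theorem theta_tmul (f g : GradedDual 𝒜) (x y : A) :
    theta 𝒜 (f ⊗ₜ g) (x ⊗ₜ y) = toDual f x * toDual g y := by
  simp [theta]

theorem theta_injective : Function.Injective (theta 𝒜) :=
  dualDistrib_injective toDual_injective toDual_injective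

theorem toDual_comp_mul_mem_range (f : GradedDual 𝒜) :
    toDual f ∘ₗ LinearMap.mul' K A ∈ LinearMap.range (theta 𝒜) := by
  classical
  obtain ⟨N, hN⟩ := exists_toDual f
  have hfin := IsGradedHopfAlgebra.finite (K := K) (𝒜 := 𝒜)
  let b := fun k => Module.finBasis K (𝒜 k)
  let p : ∀ k, A →ₗ[K] 𝒜 k := fun k =>
    DirectSum.component K ℕ (fun i => 𝒜 i) k ∘ₗ (DirectSum.decomposeLinearEquiv 𝒜).toLinearMap
  have hp : ∀ k x, p k x = DirectSum.decompose 𝒜 x k := fun _ _ => rfl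
  let u : ∀ k, Fin (Module.finrank K (𝒜 k)) → GradedDual 𝒜 := fun k i =>
    ofDual ((b k).coord i ∘ₗ p k) ⟨k + 1, fun n hn x hx => by
      rw [LinearMap.comp_apply, hp, DirectSum.decompose_of_mem 𝒜 hx, DirectSum.of_eq_of_ne _ _ _
        (by omega), map_zero]⟩
  let v : ∀ k, Fin (Module.finrank K (𝒜 k)) → GradedDual 𝒜 := fun k i =>
    ofDual (toDual f ∘ₗ LinearMap.mulLeft K (b k i : A)) ⟨N, fun n hn x hx =>
      hN (k + n) (by omega) _ (SetLike.mul_mem_graded (b k i).2 hx)⟩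
  refine ⟨∑ k ∈ Finset.range N, ∑ i, u k i ⊗ₜ v k i, ?_⟩
  refine TensorProduct.ext' fun x y => ?_
  have hx : ∀ k, ∑ i, (b k).coord i (p k x) * toDual f ((b k i : A) * y) =
      toDual f ((p k x : A) * y) := by
    intro k
    have h := congrArg (fun z : 𝒜 k => toDual f ((z : A) * y)) ((b k).sum_repr (p k x))
    simpa [Finset.sum_mul, map_sum, -Module.Basis.sum_repr] using h
  simp only [map_sum, LinearMap.sum_apply, theta_tmul, u, v, toDual_ofDual, LinearMap.comp_apply,
    LinearMap.mulLeft_apply, LinearMap.mul'_apply]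
  rw [Finset.sum_congr rfl fun k _ => hx k]
  have hbig : ∀ k, N ≤ k → toDual f ((p k x : A) * y) = 0 := by
    intro k hk
    have : toDual f ∘ₗ LinearMap.mulLeft K (p k x : A) = 0 :=
      linearMap_ext_graded (𝒜 := 𝒜) fun n y hy =>
        hN (k + n) (by omega) _ (SetLike.mul_mem_graded (p k x).2 hy)
    exact LinearMap.congr_fun this y
  have hsum := DirectSum.sum_support_decompose 𝒜 x
  conv_rhs => rw [← hsum, Finset.sum_mul, map_sum]
  refine (Finset.sum_subset (Finset.subset_union_left
    (s₂ := DFinsupp.support (DirectSum.decompose 𝒜 x))) ?_).trans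
    (Finset.sum_subset (Finset.subset_union_right (s₁ := Finset.range N)) ?_).symm
  · intro k _ hk
    exact hbig k (by simpa using hk)
  · intro k _ hk
    rw [hp, DFinsupp.notMem_support_iff.1 hk]
    simp

variable (𝒜) in
/-- The transpose of the product, through the embedding `θ`: `Δ(f)(x ⊗ y) = f(xy)`. -/
noncomputable def comulDual : GradedDual 𝒜 →ₗ[K] GradedDual 𝒜 ⊗[K] GradedDual 𝒜 :=
  (LinearEquiv.ofInjective (theta 𝒜) theta_injective).symm.toLinearMap ∘ₗ
    LinearMap.codRestrict _ ((LinearMap.mul' K A).dualMap ∘ₗ toDual) toDual_comp_mul_mem_range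

@[simp] theorem theta_comulDual (f : GradedDual 𝒜) (x y : A) :
    theta 𝒜 (comulDual 𝒜 f) (x ⊗ₜ y) = toDual f (x * y) := by
  have h : theta 𝒜 (comulDual 𝒜 f) = toDual f ∘ₗ LinearMap.mul' K A :=
    congrArg Subtype.val (LinearEquiv.apply_symm_apply
      (LinearEquiv.ofInjective (theta 𝒜) theta_injective)
      ⟨toDual f ∘ₗ LinearMap.mul' K A, toDual_comp_mul_mem_range f⟩)
  rw [h]
  simp

theorem theta_comulDual' (f : GradedDual 𝒜) (z : A ⊗[K] A) :
    theta 𝒜 (comulDual 𝒜 f) z = toDual f (LinearMap.mul' K A z) := by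
  induction z with
  | zero => simp
  | tmul x y => simp
  | add z w hz hw => simp only [map_add, hz, hw]

variable (𝒜) in
/-- The transpose of the unit, `ε(f) = f(1)`. -/
noncomputable def counitDual : GradedDual 𝒜 →ₗ[K] K :=
  LinearMap.applyₗ (1 : A) ∘ₗ toDual

@[simp] theorem counitDual_apply (f : GradedDual 𝒜) : counitDual 𝒜 f = toDual f 1 := rfl

noncomputable instance : Coalgebra K (GradedDual 𝒜) where
  comul := comulDual 𝒜
  counit := counitDual 𝒜
  coassoc := by
    refine LinearMap.ext fun f => ?_
    apply dualDistrib_injective (toDual_injective (𝒜 := 𝒜)) (theta_injective (𝒜 := 𝒜))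
    refine TensorProduct.ext' fun x yz => ?_
    induction yz with
    | zero => simp
    | add z w hz hw => simp only [TensorProduct.tmul_add, map_add, hz, hw]
    | tmul y z =>
    have h0 : ∀ (v : GradedDual 𝒜 ⊗[K] GradedDual 𝒜) (g : GradedDual 𝒜),
        (TensorProduct.dualDistrib K A (A ⊗[K] A) ∘ₗ TensorProduct.map toDual (theta 𝒜))
          (TensorProduct.assoc K _ _ _ (v ⊗ₜ[K] g)) (x ⊗ₜ (y ⊗ₜ z)) =
        theta 𝒜 v (x ⊗ₜ y) * toDual g z := by
      intro v g
      induction v with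
      | zero => simp
      | tmul a b => simp [mul_assoc]
      | add v w hv hw =>
        simp only [TensorProduct.add_tmul, map_add, LinearMap.add_apply, hv, hw, add_mul]
    have h1 : ∀ w : GradedDual 𝒜 ⊗[K] GradedDual 𝒜,
        (TensorProduct.dualDistrib K A (A ⊗[K] A) ∘ₗ TensorProduct.map toDual (theta 𝒜))
          (TensorProduct.assoc K _ _ _ ((comulDual 𝒜).rTensor _ w)) (x ⊗ₜ (y ⊗ₜ z)) =
        theta 𝒜 w ((x * y) ⊗ₜ z) := by
      intro w
      induction w with
      | zero => simp
      | tmul a b => rw [LinearMap.rTensor_tmul, h0]; simp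
      | add v w hv hw => simp only [map_add, LinearMap.add_apply, hv, hw]
    have h2 : ∀ w : GradedDual 𝒜 ⊗[K] GradedDual 𝒜,
        (TensorProduct.dualDistrib K A (A ⊗[K] A) ∘ₗ TensorProduct.map toDual (theta 𝒜))
          ((comulDual 𝒜).lTensor _ w) (x ⊗ₜ (y ⊗ₜ z)) =
        theta 𝒜 w (x ⊗ₜ (y * z)) := by
      intro w
      induction w with
      | zero => simp
      | tmul a b => simp
      | add v w hv hw => simp only [map_add, LinearMap.add_apply, hv, hw]
    refine (h1 _).trans (Eq.trans ?_ (h2 _).symm)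
    simp [mul_assoc]
  rTensor_counit_comp_comul := by
    refine LinearMap.ext fun f => (TensorProduct.lid K _).injective (toDual_injective ?_)
    refine LinearMap.ext fun x => ?_
    have h : ∀ w : GradedDual 𝒜 ⊗[K] GradedDual 𝒜,
        toDual (TensorProduct.lid K _ ((counitDual 𝒜).rTensor _ w)) x = theta 𝒜 w (1 ⊗ₜ x) := by
      intro w
      induction w with
      | zero => simp
      | tmul a b => simp
      | add v w hv hw => simp only [map_add, LinearMap.add_apply, hv, hw]
    exact (h _).trans (by simp)
  lTensor_counit_comp_comul := by
    refine LinearMap.ext fun f => (TensorProduct.rid K _).injective (toDual_injective ?_)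
    refine LinearMap.ext fun x => ?_
    have h : ∀ w : GradedDual 𝒜 ⊗[K] GradedDual 𝒜,
        toDual (TensorProduct.rid K _ ((counitDual 𝒜).lTensor _ w)) x = theta 𝒜 w (x ⊗ₜ 1) := by
      intro w
      induction w with
      | zero => simp
      | tmul a b => simp [mul_comm]
      | add v w hv hw => simp only [map_add, LinearMap.add_apply, hv, hw]
    exact (h _).trans (by simp)

theorem theta_mul (v w : GradedDual 𝒜 ⊗[K] GradedDual 𝒜) (x y : A) :
    theta 𝒜 (v * w) (x ⊗ₜ y) = LinearMap.mul' K K (TensorProduct.map (theta 𝒜 v) (theta 𝒜 w)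
      (TensorProduct.tensorTensorTensorComm K A A A A
        (comul (R := K) x ⊗ₜ comul (R := K) y))) := by
  induction v with
  | zero => simp
  | add v v' hv hv' =>
    simp only [add_mul, map_add, LinearMap.add_apply, hv, hv', TensorProduct.map_add_left]
  | tmul f g =>
  induction w with
  | zero => simp
  | add v v' hv hv' =>
    simp only [mul_add, map_add, LinearMap.add_apply, hv, hv', TensorProduct.map_add_right]
  | tmul f' g' =>
  rw [Algebra.TensorProduct.tmul_mul_tmul, theta_tmul, toDual_mul, toDual_mul]
  generalize comul (R := K) x = p
  generalize comul (R := K) y = q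
  induction p with
  | zero => simp
  | add v v' hv hv' => simp only [add_mul, map_add, TensorProduct.add_tmul, hv, hv']
  | tmul a b =>
  induction q with
  | zero => simp
  | add v v' hv hv' => simp only [mul_add, map_add, TensorProduct.tmul_add, hv, hv']
  | tmul c e =>
    simp
    ring

noncomputable instance : Bialgebra K (GradedDual 𝒜) :=
  Bialgebra.mk' K (GradedDual 𝒜)
    (by
      change toDual (1 : GradedDual 𝒜) 1 = 1
      simp [toDual_one])
    (by
      intro f g
      change toDual (f * g) 1 = toDual f 1 * toDual g 1
      simp [toDual_mul, Algebra.TensorProduct.one_def])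
    (by
      apply theta_injective
      refine TensorProduct.ext' fun x y => ?_
      rw [Algebra.TensorProduct.one_def]
      refine (theta_comulDual _ _ _).trans ?_
      simp [toDual_one])
    (by
      intro f g
      apply theta_injective
      refine TensorProduct.ext' fun x y => ?_
      refine (theta_comulDual _ _ _).trans ((theta_mul _ _ _ _).trans ?_).symm
      change LinearMap.mul' K K (TensorProduct.map (theta 𝒜 (comulDual 𝒜 f))
        (theta 𝒜 (comulDual 𝒜 g)) _) = _
      rw [toDual_mul, Bialgebra.comul_mul]
      generalize comul (R := K) x = p
      generalize comul (R := K) y = q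
      induction p with
      | zero => simp
      | add v v' hv hv' => simp only [add_mul, map_add, TensorProduct.add_tmul, hv, hv']
      | tmul a b =>
      induction q with
      | zero => simp
      | add v v' hv hv' => simp only [mul_add, map_add, TensorProduct.tmul_add, hv, hv']
      | tmul c e => simp)

variable (𝒜) in
/-- The transpose of the antipode. -/
noncomputable def antipodeDual : GradedDual 𝒜 →ₗ[K] GradedDual 𝒜 where
  toFun f := ofDual (toDual f ∘ₗ antipode K) <| by
    obtain ⟨n₀, h⟩ := exists_toDual f
    exact ⟨n₀, fun n hn x hx => h n hn _ (IsGradedHopfAlgebra.antipode_mem n x hx)⟩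
  map_add' _ _ := rfl
  map_smul' _ _ := rfl

theorem toDual_antipodeDual (f : GradedDual 𝒜) (x : A) :
    toDual (antipodeDual 𝒜 f) x = toDual f (antipode K x) := rfl

noncomputable instance : HopfAlgebra K (GradedDual 𝒜) where
  antipode := antipodeDual 𝒜
  mul_antipode_rTensor_comul := by
    refine LinearMap.ext fun f => toDual_injective (LinearMap.ext fun x => ?_)
    have h : ∀ w : GradedDual 𝒜 ⊗[K] GradedDual 𝒜,
        toDual (LinearMap.mul' K _ ((antipodeDual 𝒜).rTensor _ w)) x =
          theta 𝒜 w ((antipode K).rTensor A (comul (R := K) x)) := by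
      intro w
      induction w with
      | zero => simp
      | add v w hv hw => simp only [map_add, LinearMap.add_apply, hv, hw]
      | tmul a b =>
        rw [LinearMap.rTensor_tmul, LinearMap.mul'_apply, toDual_mul]
        generalize comul (R := K) x = p
        induction p with
        | zero => simp
        | add v v' hv hv' => simp only [map_add, hv, hv']
        | tmul a b => simp [toDual_antipodeDual]
    refine (h _).trans ((theta_comulDual' f _).trans ?_)
    rw [HopfAlgebra.mul_antipode_rTensor_comul_apply, Algebra.algebraMap_eq_smul_one, map_smul]
    change _ = toDual (algebraMap K (GradedDual 𝒜) (toDual f 1)) x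
    rw [Algebra.algebraMap_eq_smul_one, map_smul, LinearMap.smul_apply, toDual_one]
    simp [mul_comm]
  mul_antipode_lTensor_comul := by
    refine LinearMap.ext fun f => toDual_injective (LinearMap.ext fun x => ?_)
    have h : ∀ w : GradedDual 𝒜 ⊗[K] GradedDual 𝒜,
        toDual (LinearMap.mul' K _ ((antipodeDual 𝒜).lTensor _ w)) x =
          theta 𝒜 w ((antipode K).lTensor A (comul (R := K) x)) := by
      intro w
      induction w with
      | zero => simp
      | add v w hv hw => simp only [map_add, LinearMap.add_apply, hv, hw]
      | tmul a b =>
        rw [LinearMap.lTensor_tmul, LinearMap.mul'_apply, toDual_mul]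
        generalize comul (R := K) x = p
        induction p with
        | zero => simp
        | add v v' hv hv' => simp only [map_add, hv, hv']
        | tmul a b => simp [toDual_antipodeDual]
    refine (h _).trans ((theta_comulDual' f _).trans ?_)
    rw [HopfAlgebra.mul_antipode_lTensor_comul_apply, Algebra.algebraMap_eq_smul_one, map_smul]
    change _ = toDual (algebraMap K (GradedDual 𝒜) (toDual f 1)) x
    rw [Algebra.algebraMap_eq_smul_one, map_smul, LinearMap.smul_apply, toDual_one]
    simp [mul_comm]

variable (𝒜) in
/-- `γ` is homogeneous of degree `k`: it maps the component of weight `n` into the component of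
weight `n + k`, which is zero if `n + k < 0`. -/
def IsHomogeneousOfDegree (γ : A →ₗ[K] A) (k : ℤ) : Prop :=
  ∀ n, ∀ x ∈ 𝒜 n, (∃ m : ℕ, (m : ℤ) = n + k ∧ γ x ∈ 𝒜 m) ∨ γ x = 0

/-- The transpose `γ^{*g}(f) = f ∘ γ` of a homogeneous linear map. -/
noncomputable def transpose (γ : A →ₗ[K] A) {k : ℤ} (hγ : IsHomogeneousOfDegree 𝒜 γ k) :
    GradedDual 𝒜 →ₗ[K] GradedDual 𝒜 where
  toFun f := ofDual (toDual f ∘ₗ γ) <| by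
    obtain ⟨n₀, h⟩ := exists_toDual f
    refine ⟨n₀ + k.natAbs, fun n hn x hx => ?_⟩
    rcases hγ n x hx with ⟨m, hm, hmem⟩ | h0
    · exact h m (by omega) _ hmem
    · rw [LinearMap.comp_apply, h0, map_zero]
  map_add' _ _ := rfl
  map_smul' _ _ := rfl

end GradedDual

end Dual

end GradedDual

/-- Planar rooted trees decorated by `D`: a root with its decoration and the (ordered) list of the
subtrees grafted on it. Planar forests are lists of such trees. -/
inductive PTree (D : Type*) : Type _
  | node : D → List (PTree D) → PTree D

namespace PTree

variable {D : Type*}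

mutual

/-- The edges of a tree. An edge is identified with its upper end, so the edges of a tree are the
vertices of the forest obtained by deleting the root. -/
def Edge : PTree D → Type
  | node _ ts => ForestVertex ts

/-- The vertices of a forest `t :: ts`: the root of `t` (`none`), the other vertices of `t`
(which correspond to the edges of `t`), and the vertices of `ts`. -/
def ForestVertex : List (PTree D) → Type
  | [] => Empty
  | t :: ts => Option (Edge t) ⊕ ForestVertex ts

end

mutual

/-- The weight of a tree is its number of vertices. -/
def weight : PTree D → ℕ
  | node _ ts => weightForest ts + 1

/-- The weight of a forest is the sum of the weights of its trees. -/
def weightForest : List (PTree D) → ℕ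
  | [] => 0
  | t :: ts => weight t + weightForest ts

end

mutual

theorem finite_edge : (t : PTree D) → Finite (Edge t)
  | node _ ts => finite_forestVertex ts

theorem finite_forestVertex : (ts : List (PTree D)) → Finite (ForestVertex ts)
  | [] => inferInstanceAs (Finite Empty)
  | t :: ts =>
    have := finite_edge t
    have := finite_forestVertex ts
    inferInstanceAs (Finite (Option (Edge t) ⊕ ForestVertex ts))

end

noncomputable instance (t : PTree D) : Fintype (Edge t) :=
  have := finite_edge t
  Fintype.ofFinite _

mutual

/-- `Below t e e'` : the edges `e` and `e'` of `t` are distinct and `e` lies on the path from the root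
to `e'`, that is, some path of the oriented graph `t` runs through `e` and later through `e'`. -/
def Below : (t : PTree D) → Edge t → Edge t → Prop
  | node _ ts, e, e' => ForestBelow ts e e'

/-- The vertex `v` is a proper ancestor of the vertex `v'` in the forest. -/
def ForestBelow : (ts : List (PTree D)) → ForestVertex ts → ForestVertex ts → Prop
  | [], _, _ => False
  | _ :: _, .inl none, .inl (some _) => True
  | t :: _, .inl (some e), .inl (some e') => Below t e e'
  | _ :: ts, .inr v, .inr v' => ForestBelow ts v v'
  | _ :: _, _, _ => False

end

mutual

/-- `R^c(t)`: the connected component of the root after the cut `c`; the cut is given by the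
indicator function of the set of cut edges. -/
def trunk : (t : PTree D) → (Edge t → Bool) → PTree D
  | node d ts, c => node d (trunkForest ts c)

/-- The part of a forest that stays connected to the ground when, for each vertex `v` with
`c v = true`, the edge below `v` is cut. -/
def trunkForest : (ts : List (PTree D)) → (ForestVertex ts → Bool) → List (PTree D)
  | [], _ => []
  | t :: ts, c =>
    (bif c (.inl none) then [] else [trunk t fun e => c (.inl (some e))]) ++
      trunkForest ts fun v => c (.inr v)

end

mutual

/-- `P^c(t)`: the planar forest of the other components after the admissible cut `c`. -/
def pruned : (t : PTree D) → (Edge t → Bool) → List (PTree D)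
  | node _ ts, c => prunedForest ts c

/-- The planar forest that falls off when, for each vertex `v` with `c v = true`, the edge below `v`
is cut. -/
def prunedForest : (ts : List (PTree D)) → (ForestVertex ts → Bool) → List (PTree D)
  | [], _ => []
  | t :: ts, c =>
    (bif c (.inl none) then [t] else pruned t fun e => c (.inl (some e))) ++
      prunedForest ts fun v => c (.inr v)

end


/-- An admissible cut: a nonempty set of edges such that every path meets at most one of them. -/
def IsAdmissible (t : PTree D) (c : Edge t → Bool) : Prop :=
  (∃ e, c e = true) ∧ ∀ e e', c e = true → c e' = true → ¬ Below t e e'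

mutual

theorem induction {p : PTree D → Prop} (h : ∀ d ts, (∀ t ∈ ts, p t) → p (node d ts)) :
    (t : PTree D) → p t
  | node d ts => h d ts (forest_induction h ts)

theorem forest_induction {p : PTree D → Prop} (h : ∀ d ts, (∀ t ∈ ts, p t) → p (node d ts)) :
    (ts : List (PTree D)) → ∀ t ∈ ts, p t
  | [] => by simp
  | t :: ts => List.forall_mem_cons.2 ⟨induction h t, forest_induction h ts⟩

end

end PTree

/-- The free (noncommutative) `ℚ`-algebra generated by the planar rooted trees decorated by `D`. -/
abbrev HPR (D : Type*) : Type _ := FreeAlgebra ℚ (PTree D)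

namespace HPR

open PTree Finset

variable {D : Type*}

/-- A tree, as an element of the algebra. -/
noncomputable def tree (t : PTree D) : HPR D := FreeAlgebra.ι ℚ t

/-- A forest `t₁ … tₙ`, as the monomial in the algebra. -/
noncomputable def forest (F : List (PTree D)) : HPR D := (F.map tree).prod

open Classical in
/-- `Δ(t) = t ⊗ 1 + 1 ⊗ t + ∑ P^c(t) ⊗ R^c(t)`, the sum being over the admissible cuts of `t`. -/
noncomputable def comulTree (t : PTree D) : HPR D ⊗[ℚ] HPR D :=
  tree t ⊗ₜ 1 + 1 ⊗ₜ tree t +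
    ∑ c : Edge t → Bool with IsAdmissible t c, forest (pruned t c) ⊗ₜ tree (trunk t c)

/-- The coproduct: a cut of a forest `t₁ … tₙ` is a tuple of cuts (admissible, empty or total) of the
`tᵢ`, so that `Δ(t₁ … tₙ) = Δ(t₁) … Δ(tₙ)`. -/
noncomputable def comulHom (D : Type*) : HPR D →ₐ[ℚ] HPR D ⊗[ℚ] HPR D :=
  FreeAlgebra.lift ℚ comulTree

/-- The counit: it sends `1` to `1` and every nonempty forest to `0`. -/
noncomputable def counitHom (D : Type*) : HPR D →ₐ[ℚ] ℚ :=
  FreeAlgebra.lift ℚ fun _ => 0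

/-- The basis of forests; its value at `F` is `forest F`, see `forestBasis_apply`. -/
noncomputable def forestBasis (D : Type*) : Module.Basis (List (PTree D)) ℚ (HPR D) :=
  (FreeAlgebra.basisFreeMonoid ℚ (PTree D)).reindex FreeMonoid.toList

theorem forestBasis_apply (F : List (PTree D)) : forestBasis D F = forest F := by
  have h : ∀ G : FreeMonoid (PTree D), FreeAlgebra.equivMonoidAlgebraFreeMonoid.symm
      (MonoidAlgebra.of ℚ (FreeMonoid (PTree D)) G) = forest G.toList := by
    intro G
    induction G using FreeMonoid.inductionOn' with
    | one => rw [map_one, map_one]; rfl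
    | of_mul x xs ih =>
      rw [map_mul, map_mul, ih]
      simp [forest, tree, FreeAlgebra.equivMonoidAlgebraFreeMonoid]
  simpa [forestBasis, FreeAlgebra.basisFreeMonoid] using! h (FreeMonoid.ofList F)

/-- `B_d^+`: the linear map that grafts the trees of a forest on a common root decorated by `d`. -/
noncomputable def graft (d : D) : HPR D →ₗ[ℚ] HPR D :=
  (forestBasis D).constr ℚ fun F => tree (node d F)

open Classical in
/-- `γ_d` deletes the last tree of a forest if this tree is the single vertex decorated by `d`, and
sends all other forests (the empty one included) to `0`. -/
noncomputable def gamma (d : D) : HPR D →ₗ[ℚ] HPR D :=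
  (forestBasis D).constr ℚ fun F =>
    if F.getLast? = some (node d []) then forest F.dropLast else 0

theorem graft_forest (d : D) (F : List (PTree D)) : graft d (forest F) = tree (node d F) := by
  rw [graft, ← forestBasis_apply, Module.Basis.constr_basis]

@[simp] theorem forest_nil : forest ([] : List (PTree D)) = 1 := rfl

@[simp] theorem forest_cons (t : PTree D) (F : List (PTree D)) :
    forest (t :: F) = tree t * forest F := by simp [forest]

@[simp] theorem forest_append (F G : List (PTree D)) :
    forest (F ++ G) = forest F * forest G := by simp [forest]

@[simp] theorem comulHom_tree (t : PTree D) : comulHom D (tree t) = comulTree t := by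
  simp [comulHom, tree]

@[simp] theorem counitHom_tree (t : PTree D) : counitHom D (tree t) = 0 := by
  simp [counitHom, tree]

mutual

theorem trunk_empty : (t : PTree D) → trunk t (fun _ => false) = t
  | node d ts => congrArg (node d) (trunkForest_empty ts)

theorem trunkForest_empty : (ts : List (PTree D)) → trunkForest ts (fun _ => false) = ts
  | [] => rfl
  | t :: ts => congrArg₂ List.cons (trunk_empty t) (trunkForest_empty ts)

end

mutual

theorem pruned_empty : (t : PTree D) → pruned t (fun _ => false) = []
  | node _ ts => prunedForest_empty ts

theorem prunedForest_empty : (ts : List (PTree D)) → prunedForest ts (fun _ => false) = []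
  | [] => rfl
  | t :: ts => congrArg₂ (· ++ ·) (pruned_empty t) (prunedForest_empty ts)

end

open Classical in
theorem comulTree_eq (t : PTree D) : comulTree t = tree t ⊗ₜ 1 +
    ∑ c : Edge t → Bool, if (∀ e e', c e = true → c e' = true → ¬ Below t e e') then
      forest (pruned t c) ⊗ₜ[ℚ] tree (trunk t c) else 0 := by
  rw [comulTree, add_assoc]
  congr 1
  rw [← Finset.add_sum_erase _ _ (Finset.mem_univ (fun _ => false)), if_pos (by simp),
    trunk_empty, pruned_empty, forest_nil]
  congr 1
  rw [← Finset.sum_filter]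
  refine Finset.sum_congr ?_ fun _ _ => rfl
  ext c
  rw [Finset.mem_filter, Finset.mem_filter, Finset.mem_erase]
  simp [IsAdmissible, funext_iff]

noncomputable instance (ts : List (PTree D)) : Fintype (ForestVertex ts) :=
  have := finite_forestVertex ts
  Fintype.ofFinite _

/-- A cut of the forest `t :: ts` amounts to the choice whether the root of `t` is cut off, and cuts of
`t` and `ts`. -/
def cutEquiv (t : PTree D) (ts : List (PTree D)) :
    (ForestVertex (t :: ts) → Bool) ≃ (Bool × (Edge t → Bool)) × (ForestVertex ts → Bool) where
  toFun c := ((c (.inl none), fun e => c (.inl (some e))), fun v => c (.inr v))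
  invFun p := Sum.elim (fun o => o.elim p.1.1 p.1.2) p.2
  left_inv c := by
    funext v
    rcases v with (_ | e) | v <;> rfl
  right_inv p := rfl

theorem antichain_cons (t : PTree D) (ts : List (PTree D)) (c : ForestVertex (t :: ts) → Bool) :
    (∀ v v', c v = true → c v' = true → ¬ ForestBelow (t :: ts) v v') ↔
      ((c (.inl none) = true → ∀ e, c (.inl (some e)) = false) ∧
        ∀ e e', c (.inl (some e)) = true → c (.inl (some e')) = true → ¬ Below t e e') ∧
      ∀ v v', c (.inr v) = true → c (.inr v') = true → ¬ ForestBelow ts v v' := by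
  constructor
  · intro h
    refine ⟨⟨fun h0 e => ?_, fun e e' he he' hb => h _ _ he he' hb⟩,
      fun v v' hv hv' hb => h _ _ hv hv' hb⟩
    by_contra h1
    exact h (.inl none) (.inl (some e)) h0 (by simpa using h1) trivial
  · rintro ⟨⟨h1, h2⟩, h3⟩ v v' hv hv' hb
    rcases v with (_ | e) | v <;> rcases v' with (_ | e') | v'
    · exact hb
    · simp [h1 hv e'] at hv'
    · exact hb
    · exact hb
    · exact h2 _ _ hv hv' hb
    · exact hb
    · exact hb
    · exact hb
    · exact h3 _ _ hv hv' hb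

open Classical in
theorem sum_forest_cuts : (ts : List (PTree D)) →
    (∑ c : ForestVertex ts → Bool,
      if (∀ v v', c v = true → c v' = true → ¬ ForestBelow ts v v') then
        forest (prunedForest ts c) ⊗ₜ[ℚ] forest (trunkForest ts c) else 0) = comulHom D (forest ts)
  | [] => by
    rw [forest_nil, map_one, Finset.sum_eq_single (fun _ => false)]
    · rw [if_pos (by simp)]; rfl
    · intro b _ hb
      exact absurd (funext fun v => Empty.elim v) hb
    · simp
  | t :: ts => by
    rw [forest_cons, map_mul, ← sum_forest_cuts ts, comulHom_tree, comulTree_eq,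
      ← Equiv.sum_comp (cutEquiv t ts).symm, Fintype.sum_prod_type, Fintype.sum_prod_type,
      Fintype.sum_bool, add_mul, Finset.sum_mul_sum]
    congr 1
    · rw [Finset.sum_eq_single (fun _ => false)]
      · rw [Finset.mul_sum]
        refine Finset.sum_congr rfl fun c _ => ?_
        rw [mul_ite, mul_zero]
        refine if_congr ?_ ?_ rfl
        · rw [antichain_cons]
          change ((true = true → ∀ _ : Edge t, false = false) ∧
            ∀ e e' : Edge t, false = true → false = true → ¬ Below t e e') ∧
            (∀ v v', c v = true → c v' = true → ¬ ForestBelow ts v v') ↔ _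
          simp
        · change forest ([t] ++ prunedForest ts c) ⊗ₜ forest ([] ++ trunkForest ts c) = _
          simp
      · intro b _ hb
        refine Finset.sum_eq_zero fun c _ => if_neg ?_
        rw [antichain_cons]
        rintro ⟨⟨h, -⟩, -⟩
        exact hb (funext fun e => h rfl e)
      · simp
    · refine Finset.sum_congr rfl fun b _ => Finset.sum_congr rfl fun c _ => ?_
      rw [ite_zero_mul_ite_zero]
      refine if_congr ?_ ?_ rfl
      · rw [antichain_cons]
        change ((false = true → ∀ e : Edge t, b e = false) ∧
          ∀ e e' : Edge t, b e = true → b e' = true → ¬ Below t e e') ∧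
          (∀ v v', c v = true → c v' = true → ¬ ForestBelow ts v v') ↔ _
        simp
      · change forest (pruned t b ++ prunedForest ts c) ⊗ₜ
          forest ([trunk t b] ++ trunkForest ts c) = _
        simp

theorem comulHom_graft (d : D) (x : HPR D) :
    comulHom D (graft d x) = graft d x ⊗ₜ 1 + (graft d).lTensor (HPR D) (comulHom D x) := by
  have h : (comulHom D).toLinearMap ∘ₗ graft d =
      (TensorProduct.mk ℚ (HPR D) (HPR D)).flip 1 ∘ₗ graft d +
        (graft d).lTensor (HPR D) ∘ₗ (comulHom D).toLinearMap := by
    classical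
    refine (forestBasis D).ext fun F => ?_
    have h : comulHom D (forest F) = _ := (sum_forest_cuts F).symm
    simp only [LinearMap.comp_apply, LinearMap.add_apply, AlgHom.toLinearMap_apply,
      forestBasis_apply, graft_forest, comulHom_tree, comulTree_eq, h, map_sum]
    refine congrArg₂ (· + ·) rfl ?_
    refine Fintype.sum_congr _ _ fun c => ?_
    rw [apply_ite ((graft d).lTensor (HPR D)), map_zero, LinearMap.lTensor_tmul, graft_forest]
    rfl
  exact LinearMap.congr_fun h x

theorem counitHom_graft (d : D) (x : HPR D) : counitHom D (graft d x) = 0 := by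
  have h : (counitHom D).toLinearMap ∘ₗ graft d = 0 :=
    (forestBasis D).ext fun F => by simp [forestBasis_apply, graft_forest]
  exact LinearMap.congr_fun h x

theorem algHom_ext_graft {B : Type*} [Semiring B] [Algebra ℚ B] {f g : HPR D →ₐ[ℚ] B}
    (h : ∀ d x, f x = g x → f (graft d x) = g (graft d x)) : f = g := by
  refine FreeAlgebra.hom_ext (funext fun t => ?_)
  change f (tree t) = g (tree t)
  induction t using PTree.induction with
  | _ d ts ih =>
    rw [← graft_forest]
    refine h d _ ?_
    rw [forest, map_list_prod, map_list_prod, List.map_map, List.map_map]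
    exact congrArg List.prod (List.map_congr_left ih)

noncomputable instance : Bialgebra ℚ (HPR D) :=
  Bialgebra.ofAlgHom (comulHom D) (counitHom D)
    (by
      refine algHom_ext_graft fun d x hx => ?_
      have h0 : ∀ (z : HPR D ⊗[ℚ] HPR D) (b : HPR D),
          Algebra.TensorProduct.assoc ℚ ℚ ℚ (HPR D) (HPR D) (HPR D) (z ⊗ₜ graft d b) =
          ((graft d).lTensor (HPR D)).lTensor (HPR D)
            (Algebra.TensorProduct.assoc ℚ ℚ ℚ (HPR D) (HPR D) (HPR D) (z ⊗ₜ b)) := by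
        intro z b
        induction z with
        | zero => simp
        | tmul a c => simp
        | add z w hz hw => simp only [TensorProduct.add_tmul, map_add, hz, hw]
      have h1 : ∀ y : HPR D ⊗[ℚ] HPR D, Algebra.TensorProduct.assoc ℚ ℚ ℚ (HPR D) (HPR D) (HPR D)
          (Algebra.TensorProduct.map (comulHom D) (.id ℚ (HPR D))
            ((graft d).lTensor (HPR D) y)) =
          ((graft d).lTensor (HPR D)).lTensor (HPR D)
            (Algebra.TensorProduct.assoc ℚ ℚ ℚ (HPR D) (HPR D) (HPR D)
              (Algebra.TensorProduct.map (comulHom D) (.id ℚ (HPR D)) y)) := by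
        intro y
        induction y with
        | zero => simp
        | tmul a b => simp [h0]
        | add z w hz hw => simp only [map_add, hz, hw]
      have h2 : ∀ y : HPR D ⊗[ℚ] HPR D, Algebra.TensorProduct.map (.id ℚ (HPR D)) (comulHom D)
          ((graft d).lTensor (HPR D) y) =
          Algebra.TensorProduct.assoc ℚ ℚ ℚ (HPR D) (HPR D) (HPR D)
            ((graft d).lTensor (HPR D) y ⊗ₜ 1) +
          ((graft d).lTensor (HPR D)).lTensor (HPR D)
            (Algebra.TensorProduct.map (.id ℚ (HPR D)) (comulHom D) y) := by
        intro y
        induction y with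
        | zero => simp
        | tmul a b => simp [comulHom_graft, TensorProduct.tmul_add]
        | add z w hz hw =>
          simp only [map_add, hz, hw, TensorProduct.add_tmul]
          abel
      simp only [AlgHom.comp_apply] at hx ⊢
      replace hx : Algebra.TensorProduct.assoc ℚ ℚ ℚ (HPR D) (HPR D) (HPR D)
        (Algebra.TensorProduct.map (comulHom D) (.id ℚ (HPR D)) (comulHom D x)) = _ := hx
      change Algebra.TensorProduct.assoc ℚ ℚ ℚ (HPR D) (HPR D) (HPR D)
        (Algebra.TensorProduct.map (comulHom D) (.id ℚ (HPR D)) (comulHom D (graft d x))) = _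
      simp only [comulHom_graft, map_add, h1, h2, hx, Algebra.TensorProduct.map_tmul,
        TensorProduct.add_tmul, map_one, AlgHom.id_apply]
      simp [Algebra.TensorProduct.one_def, add_assoc])
    (by
      refine algHom_ext_graft fun d x hx => ?_
      have h1 : ∀ y : HPR D ⊗[ℚ] HPR D, Algebra.TensorProduct.map (counitHom D) (.id ℚ (HPR D))
          ((graft d).lTensor (HPR D) y) = (graft d).lTensor ℚ
            (Algebra.TensorProduct.map (counitHom D) (.id ℚ (HPR D)) y) := by
        intro y
        induction y with
        | zero => simp
        | tmul a b => simp
        | add z w hz hw => simp only [map_add, hz, hw]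
      simp only [AlgHom.comp_apply] at hx ⊢
      rw [comulHom_graft, map_add, h1, hx]
      simp [counitHom_graft])
    (by
      refine algHom_ext_graft fun d x hx => ?_
      have h1 : ∀ y : HPR D ⊗[ℚ] HPR D, Algebra.TensorProduct.map (.id ℚ (HPR D)) (counitHom D)
          ((graft d).lTensor (HPR D) y) = 0 := by
        intro y
        induction y with
        | zero => simp
        | tmul a b => simp [counitHom_graft]
        | add z w hz hw => simp only [map_add, hz, hw, add_zero]
      rw [AlgHom.comp_apply, comulHom_graft, map_add, h1]
      simp)

theorem comul_eq (x : HPR D) : Coalgebra.comul (R := ℚ) x = comulHom D x := rfl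

theorem counit_eq (x : HPR D) : Coalgebra.counit (R := ℚ) x = counitHom D x := rfl

theorem weightForest_append (F G : List (PTree D)) :
    weightForest (F ++ G) = weightForest F + weightForest G := by
  induction F with
  | nil => simp [weightForest]
  | cons t F ih => simp [weightForest, ih, add_assoc]

/-- The homogeneous component of weight `n`: the span of the forests of weight `n`. -/
def weightGrading (D : Type*) (n : ℕ) : Submodule ℚ (HPR D) :=
  Submodule.span ℚ (forest '' {F : List (PTree D) | weightForest F = n})

theorem forest_mem (F : List (PTree D)) : forest F ∈ weightGrading D (weightForest F) :=
  Submodule.subset_span ⟨F, rfl, rfl⟩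

theorem tree_mem (t : PTree D) : tree t ∈ weightGrading D (weight t) := by
  simpa [weightForest] using forest_mem [t]

instance : SetLike.GradedMonoid (weightGrading D) where
  one_mem := forest_mem []
  mul_mem i j x y hx hy := by
    have h : weightGrading D i * weightGrading D j ≤ weightGrading D (i + j) := by
      rw [weightGrading, weightGrading, Submodule.span_mul_span, Submodule.span_le]
      rintro _ ⟨_, ⟨F, rfl, rfl⟩, _, ⟨G, rfl, rfl⟩, rfl⟩
      change forest F * forest G ∈ _
      rw [← forest_append, ← weightForest_append]
      exact forest_mem _
    exact h (Submodule.mul_mem_mul hx hy)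

noncomputable instance : GradedAlgebra (weightGrading D) :=
  GradedAlgebra.ofAlgHom _
    (FreeAlgebra.lift ℚ fun t => DirectSum.of (fun i => weightGrading D i) (weight t)
      ⟨tree t, tree_mem t⟩)
    (by
      ext t
      simp [tree])
    (by
      rintro i ⟨x, hx⟩
      simp only
      induction hx using Submodule.span_induction with
      | zero => rw [map_zero]; exact (map_zero _).symm
      | add x y hx hy ihx ihy =>
        rw [map_add, ihx, ihy, ← map_add]
        rfl
      | smul a x hx ih =>
        rw [map_smul, ih]
        exact ((DirectSum.lof ℚ ℕ (fun i => weightGrading D i) i).map_smul a ⟨x, hx⟩).symm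
      | mem x hx =>
        obtain ⟨F, rfl, rfl⟩ := hx
        induction F with
        | nil => simp only [forest_nil, map_one]; rfl
        | cons t F ih =>
          have ht : FreeAlgebra.lift ℚ (fun t => DirectSum.of (fun i => weightGrading D i) (weight t)
              ⟨tree t, tree_mem t⟩) (tree t) = DirectSum.of (fun i => weightGrading D i) (weight t)
              ⟨tree t, tree_mem t⟩ := FreeAlgebra.lift_ι_apply _ _
          simp only [forest_cons, map_mul, ih, ht, DirectSum.of_mul_of]
          rfl)

mutual

theorem weight_cut : (t : PTree D) → (c : Edge t → Bool) →
    weightForest (pruned t c) + weight (trunk t c) = weight t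
  | node _ ts, c => congrArg (· + 1) (weightForest_cut ts c)

theorem weightForest_cut : (ts : List (PTree D)) → (c : ForestVertex ts → Bool) →
    weightForest (prunedForest ts c) + weightForest (trunkForest ts c) = weightForest ts
  | [], _ => rfl
  | t :: ts, c => by
    have h1 := weight_cut t fun e => c (.inl (some e))
    have h2 := weightForest_cut ts fun v => c (.inr v)
    rw [prunedForest, trunkForest, weightForest_append, weightForest_append]
    cases c (.inl none) <;> simp [weightForest] <;> omega

end

theorem finite_weight [Finite D] (n : ℕ) : {F : List (PTree D) | weightForest F ≤ n}.Finite := by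
  induction n with
  | zero =>
    refine (Set.finite_singleton []).subset fun F hF => ?_
    rcases F with _ | ⟨⟨d, G⟩, F⟩
    · rfl
    · simp [weightForest, weight] at hF
  | succ n ih =>
    refine ((Set.finite_singleton []).union (((Set.finite_univ (α := D)).prod (ih.prod ih)).image
      fun p => node p.1 p.2.1 :: p.2.2)).subset fun F hF => ?_
    rcases F with _ | ⟨⟨d, G⟩, F⟩
    · exact Or.inl rfl
    · simp only [weightForest, weight, Set.mem_ofPred_eq] at hF
      exact Or.inr ⟨(d, G, F), ⟨trivial, by simp; omega, by simp; omega⟩, rfl⟩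

instance [Finite D] (n : ℕ) : FiniteDimensional ℚ (weightGrading D n) :=
  FiniteDimensional.span_of_finite ℚ
    (((finite_weight n).subset fun _ h => le_of_eq h).image _)

theorem tensorGrading_mul_mem {m n : ℕ} {z w : HPR D ⊗[ℚ] HPR D}
    (hz : z ∈ tensorGrading (weightGrading D) m) (hw : w ∈ tensorGrading (weightGrading D) n) :
    z * w ∈ tensorGrading (weightGrading D) (m + n) := by
  have h : tensorGrading (weightGrading D) m * tensorGrading (weightGrading D) n ≤
      tensorGrading (weightGrading D) (m + n) := by
    rw [tensorGrading, tensorGrading, Submodule.span_mul_span, Submodule.span_le]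
    rintro _ ⟨_, ⟨k, l, a, b, rfl, ha, hb, rfl⟩, _, ⟨k', l', a', b', rfl, ha', hb', rfl⟩, rfl⟩
    exact Submodule.subset_span ⟨k + k', l + l', a * a', b * b', by omega,
      SetLike.mul_mem_graded ha ha', SetLike.mul_mem_graded hb hb',
      Algebra.TensorProduct.tmul_mul_tmul _ _ _ _⟩
  exact h (Submodule.mul_mem_mul hz hw)

theorem tmul_mem {m n k : ℕ} {a b : HPR D} (ha : a ∈ weightGrading D m)
    (hb : b ∈ weightGrading D n) (h : m + n = k) :
    a ⊗ₜ b ∈ tensorGrading (weightGrading D) k :=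
  Submodule.subset_span ⟨m, n, a, b, h, ha, hb, rfl⟩

theorem one_mem_weightGrading : (1 : HPR D) ∈ weightGrading D 0 := forest_mem []

theorem comulTree_mem (t : PTree D) : comulTree t ∈ tensorGrading (weightGrading D) (weight t) :=
  add_mem (add_mem (tmul_mem (tree_mem t) one_mem_weightGrading (add_zero _))
    (tmul_mem one_mem_weightGrading (tree_mem t) (zero_add _)))
    (sum_mem fun c _ => tmul_mem (forest_mem _) (tree_mem _) (weight_cut t c))

theorem comul_mem (n : ℕ) (x : HPR D) (hx : x ∈ weightGrading D n) :
    Coalgebra.comul (R := ℚ) x ∈ tensorGrading (weightGrading D) n := by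
  rw [comul_eq]
  induction hx using Submodule.span_induction with
  | zero => simp
  | add x y _ _ hx hy => simpa only [map_add] using add_mem hx hy
  | smul r x _ hx => simpa only [map_smul] using Submodule.smul_mem _ r hx
  | mem x hx =>
    obtain ⟨F, rfl, rfl⟩ := hx
    induction F with
    | nil =>
      rw [forest_nil, map_one]
      exact tmul_mem one_mem_weightGrading one_mem_weightGrading rfl
    | cons t F ih =>
      rw [forest_cons, map_mul, comulHom_tree]
      exact tensorGrading_mul_mem (comulTree_mem t) ih

theorem counit_eq_zero (n : ℕ) (hn : n ≠ 0) (x : HPR D) (hx : x ∈ weightGrading D n) :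
    Coalgebra.counit (R := ℚ) x = 0 := by
  rw [counit_eq]
  induction hx using Submodule.span_induction with
  | zero => simp
  | add x y _ _ hx hy => rw [map_add, hx, hy, add_zero]
  | smul r x _ hx => rw [map_smul, hx, smul_zero]
  | mem x hx =>
    obtain ⟨F, rfl, rfl⟩ := hx
    cases F with
    | nil => exact absurd rfl hn
    | cons t F => rw [forest_cons, map_mul, counitHom_tree, zero_mul]

theorem algebraMap_counit (x : HPR D) (hx : x ∈ weightGrading D 0) :
    algebraMap ℚ (HPR D) (Coalgebra.counit (R := ℚ) x) = x := by
  rw [counit_eq]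
  induction hx using Submodule.span_induction with
  | zero => simp
  | add x y _ _ hx hy => rw [map_add, map_add, hx, hy]
  | smul r x _ hx => rw [map_smul, smul_eq_mul, map_mul, hx, Algebra.smul_def]
  | mem x hx =>
    obtain ⟨F, hF, rfl⟩ := hx
    rcases F with _ | ⟨⟨d, G⟩, F⟩
    · simp
    · simp [weightForest, weight] at hF

/-- The antipode is the convolution inverse of the identity. -/
noncomputable instance : HopfAlgebra ℚ (HPR D) :=
  HopfAlgebra.ofConvInverse (convInverse (weightGrading D))
    (convInverse_mul comul_mem algebraMap_counit) (mul_convInverse comul_mem algebraMap_counit)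

instance [Finite D] : IsGradedHopfAlgebra (weightGrading D) where
  comul_mem := comul_mem
  counit_eq_zero := counit_eq_zero
  antipode_mem := convInverse_mem comul_mem counit_eq_zero
  finite := inferInstance

theorem gamma_forest (d : D) (F : List (PTree D)) [Decidable (F.getLast? = some (node d []))] :
    gamma d (forest F) = if F.getLast? = some (node d []) then forest F.dropLast else 0 := by
  rw [gamma, ← forestBasis_apply, Module.Basis.constr_basis]
  congr

theorem gamma_homogeneous (d : D) :
    GradedDual.IsHomogeneousOfDegree (weightGrading D) (gamma d) (-1) := by
  classical
  intro n x hx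
  rcases n with _ | n
  · right
    induction hx using Submodule.span_induction with
    | zero => simp
    | add x y _ _ hx hy => rw [map_add, hx, hy, add_zero]
    | smul r x _ hx => rw [map_smul, hx, smul_zero]
    | mem x hx =>
      obtain ⟨F, hF, rfl⟩ := hx
      rcases F with _ | ⟨⟨d, G⟩, F⟩
      · simp [gamma_forest, -forest_nil]
      · simp [weightForest, weight] at hF
  · left
    refine ⟨n, by simp, ?_⟩
    induction hx using Submodule.span_induction with
    | zero => simp
    | add x y _ _ hx hy => simpa only [map_add] using add_mem hx hy
    | smul r x _ hx => simpa only [map_smul] using Submodule.smul_mem _ r hx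
    | mem x hx =>
      obtain ⟨F, hF, rfl⟩ := hx
      rw [gamma_forest]
      split_ifs with h
      · have h2 : weightForest F = n + 1 := hF
        rw [← List.dropLast_append_getLast? _ h, weightForest_append] at h2
        obtain rfl : weightForest F.dropLast = n := by
          simpa [weightForest, weight] using h2
        exact forest_mem _
      · exact zero_mem _

/-- The transpose `γ_d^{*g}` on the graded dual. -/
noncomputable def gammaDual [Finite D] (d : D) :
    GradedDual (weightGrading D) →ₗ[ℚ] GradedDual (weightGrading D) :=
  GradedDual.transpose (gamma d) (gamma_homogeneous d)

end HPR

/-!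
The algebra `H` is universal among algebras with a family of linear operators `L d`: exactly one
algebra morphism turns each `B_d^+` into `L d`, and it is a morphism of bialgebras as soon as the
`L d` are Hochschild `1`-cocycles. The operator `γ_d` is an `ε`-derivation, the notion dual to that
of a cocycle, so its transpose `γ_d^{*g}` is a cocycle, and `Ψ` exists and is unique. Dually, the
transpose of the cocycle `B_d^+` is an `ε`-derivation, and the rule
`γ_d (y B_e^+(x)) = δ_{d,e} ε(x) y` implies that `Ψ` also intertwines `γ_d` with `(B_d^+)^{*g}`.

A coalgebra morphism `f` that intertwines `γ_d` with some linear map for every `d` is injective. By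
induction on the weight, `f x = 0` forces `ε(x) = 0` and `(id ⊗ γ_d) Δ(x) = 0` for all `d`, because
`f ⊗ f` is injective in lower weight. Such an `x` is zero: it is a sum of products `y B_e^+(u)`,
and `(id ⊗ γ_d) Δ(y B_e^+(u))` is `δ_{d,e} u ⊗ y` up to terms whose second factor has smaller weight
than `y`. Finally `H_n` and `(H^{*g})_n` have the same finite dimension, so the injective graded
morphism `Ψ` is bijective.
-/

section Cocycles

open Coalgebra

variable {R A : Type*} [CommRing R] [Ring A] [Bialgebra R A]

/-- A Hochschild `1`-cocycle of a bialgebra: `Δ ∘ L = L ⊗ 1 + (id ⊗ L) ∘ Δ`. The grafting operators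
`B_d^+` are the universal examples. -/
def IsHochschildCocycle (L : A →ₗ[R] A) : Prop :=
  ∀ x, comul (R := R) (L x) = L x ⊗ₜ[R] 1 + L.lTensor A (comul x)

/-- An `ε`-derivation of a bialgebra, for the left regular and the right trivial action:
`γ(xy) = ε(y) γ(x) + x γ(y)`. This is the notion dual to Hochschild `1`-cocycles. -/
def IsCounitDerivation (γ : A →ₗ[R] A) : Prop :=
  ∀ x y, γ (x * y) = counit (R := R) y • γ x + x * γ y

theorem IsHochschildCocycle.counit_apply {L : A →ₗ[R] A} (hL : IsHochschildCocycle L) (x : A) :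
    counit (R := R) (L x) = 0 := by
  have hcomm : ∀ z : A ⊗[R] A, (counit (R := R)).rTensor A (L.lTensor A z) =
      L.lTensor R ((counit (R := R)).rTensor A z) := fun z => by
    rw [← LinearMap.comp_apply, ← LinearMap.comp_apply, LinearMap.rTensor_comp_lTensor,
      LinearMap.lTensor_comp_rTensor]
  have h : counit (R := R) (L x) ⊗ₜ[R] (1 : A) = 0 := by
    have h := congrArg ((counit (R := R)).rTensor A) (hL x)
    rwa [map_add, hcomm, rTensor_counit_comul, rTensor_counit_comul, LinearMap.rTensor_tmul,
      LinearMap.lTensor_tmul, right_eq_add] at h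
  simpa using congrArg (TensorProduct.lid R R ∘ (counit (R := R) (A := A)).lTensor R) h

theorem IsCounitDerivation.apply_one {γ : A →ₗ[R] A} (hγ : IsCounitDerivation γ) : γ 1 = 0 := by
  simpa using hγ 1 1

end Cocycles

open WithConv in
theorem bialgHom_map_antipode {R A B : Type*} [CommRing R] [Ring A] [Ring B] [HopfAlgebra R A]
    [HopfAlgebra R B] (f : A →ₐc[R] B) (x : A) :
    f (HopfAlgebra.antipode R x) = HopfAlgebra.antipode R (f x) := by
  let φ : A →ₐ[R] B := f
  let ψ : A →ₗc[R] B := f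
  have hleft : toConv (φ.toLinearMap ∘ₗ HopfAlgebra.antipode R) * toConv φ.toLinearMap = 1 := by
    have h := LinearMap.algHom_comp_convMul_distrib φ (toConv (HopfAlgebra.antipode R))
      (toConv LinearMap.id)
    rw [LinearMap.antipode_mul_id] at h
    refine ofConv_injective (h.symm.trans (LinearMap.ext fun a => ?_))
    exact φ.commutes _
  have hright : toConv φ.toLinearMap * toConv (HopfAlgebra.antipode R ∘ₗ φ.toLinearMap) = 1 := by
    have h := LinearMap.convMul_comp_coalgHom_distrib (toConv LinearMap.id)
      (toConv (HopfAlgebra.antipode R)) ψ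
    rw [LinearMap.id_mul_antipode] at h
    refine ofConv_injective (h.symm.trans (LinearMap.ext fun a => ?_))
    exact congrArg (algebraMap R B) (CoalgHomClass.counit_comp_apply f a)
  exact LinearMap.congr_fun (congrArg ofConv (left_inv_eq_right_inv hleft hright)) x

namespace GradedDual

open Coalgebra

variable {K A : Type*} [Field K] [Ring A] [HopfAlgebra K A] {𝒜 : ℕ → Submodule K A}
  [GradedAlgebra 𝒜] [IsGradedHopfAlgebra 𝒜]

theorem theta_comul (f : GradedDual 𝒜) (x y : A) :
    theta 𝒜 (comul (R := K) f) (x ⊗ₜ y) = toDual f (x * y) :=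
  theta_comulDual f x y

instance : SetLike.GradedMonoid (grading 𝒜) where
  one_mem k hk x hx := by
    rw [toDual_one, IsGradedHopfAlgebra.counit_eq_zero (K := K) (𝒜 := 𝒜) k hk x hx]
  mul_mem {m n f g} hf hg k hk x hx := by
    refine (conv_congr 𝒜 f.1 g.1 0 0 (IsGradedHopfAlgebra.comul_mem k x hx) ?_).trans (by simp)
    intro i j a b hij ha hb
    change toDual f a * toDual g b = 0 * 0
    obtain hi | hj : i ≠ m ∨ j ≠ n := by omega
    · rw [hf i hi a ha, zero_mul, zero_mul]
    · rw [hg j hj b hb, mul_zero, zero_mul]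

section Transpose

variable {γ : A →ₗ[K] A} {k : ℤ} (hγ : IsHomogeneousOfDegree 𝒜 γ k)

theorem toDual_transpose (f : GradedDual 𝒜) (x : A) :
    toDual (transpose γ hγ f) x = toDual f (γ x) := rfl

theorem transpose_mem_grading {m n : ℕ} (hmn : m + k = n) {f : GradedDual 𝒜}
    (hf : f ∈ grading 𝒜 n) : transpose γ hγ f ∈ grading 𝒜 m := by
  intro i hi x hx
  rw [toDual_transpose]
  rcases hγ i x hx with ⟨j, hj, hmem⟩ | h0
  · exact hf j (by omega) _ hmem
  · rw [h0, map_zero]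

theorem isHochschildCocycle_transpose (h : IsCounitDerivation γ) :
    IsHochschildCocycle (transpose γ hγ) := by
  intro f
  refine theta_injective (TensorProduct.ext' fun x y => ?_)
  have htheta : ∀ w, theta 𝒜 ((transpose γ hγ).lTensor _ w) (x ⊗ₜ y) =
      theta 𝒜 w (x ⊗ₜ γ y) := fun w => by
    induction w with
    | zero => simp only [map_zero, LinearMap.zero_apply]
    | tmul a b => rw [LinearMap.lTensor_tmul, theta_tmul, theta_tmul, toDual_transpose]
    | add v w hv hw => simp only [map_add, LinearMap.add_apply, hv, hw]
  rw [map_add, LinearMap.add_apply, htheta, theta_comul, theta_comul, theta_tmul,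
    toDual_transpose, toDual_transpose, toDual_one, h, map_add, map_smul, smul_eq_mul, mul_comm]

theorem isCounitDerivation_transpose (h : IsHochschildCocycle γ) :
    IsCounitDerivation (transpose γ hγ) := by
  intro f g
  refine toDual_injective (LinearMap.ext fun x => ?_)
  have hpair : ∀ z : A ⊗[K] A, TensorProduct.map (toDual f) (toDual g) (γ.lTensor A z) =
      TensorProduct.map (toDual f) (toDual (transpose γ hγ g)) z := fun z => by
    rw [← LinearMap.comp_apply, LinearMap.map_comp_lTensor]
    rfl
  rw [toDual_transpose, toDual_mul, h, map_add, map_add, hpair, map_add, map_smul,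
    LinearMap.add_apply, LinearMap.smul_apply, toDual_mul, toDual_transpose,
    TensorProduct.map_tmul, LinearMap.mul'_apply, smul_eq_mul, mul_comm]
  rfl

end Transpose

theorem iSup_grading : ⨆ n, grading 𝒜 n = ⊤ := by
  refine eq_top_iff.2 fun f _ => ?_
  obtain ⟨N, hN⟩ := exists_toDual f
  induction N generalizing f with
  | zero =>
    obtain rfl : f = 0 := toDual_injective <| linearMap_ext_graded (𝒜 := 𝒜) fun n x hx => by
      rw [hN n n.zero_le x hx, map_zero, LinearMap.zero_apply]
    exact zero_mem _
  | succ N ih =>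
    have hproj : ∀ n ≠ N, ∀ x ∈ 𝒜 n, toDual f (GradedAlgebra.proj 𝒜 N x) = 0 :=
      fun n hn x hx => by
        rw [GradedAlgebra.proj_apply, DirectSum.decompose_of_mem_ne 𝒜 hx hn, map_zero]
    let g : GradedDual 𝒜 := ofDual (toDual f ∘ₗ GradedAlgebra.proj 𝒜 N)
      ⟨N + 1, fun n hn => hproj n (by omega)⟩
    have hg : g ∈ ⨆ n, grading 𝒜 n := Submodule.mem_iSup_of_mem N hproj
    have hfg : ∀ n ≥ N, ∀ x ∈ 𝒜 n, toDual (f - g) x = 0 := fun n hn x hx => by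
      rw [map_sub, LinearMap.sub_apply, toDual_ofDual, LinearMap.comp_apply]
      rcases hn.eq_or_lt with rfl | hn
      · rw [GradedAlgebra.proj_apply, DirectSum.decompose_of_mem_same 𝒜 hx, sub_self]
      · rw [hN n hn x hx, hproj n hn.ne' x hx, sub_zero]
    exact sub_add_cancel f g ▸ add_mem (ih (f - g) trivial hfg) hg

variable (𝒜) in
/-- The restriction of the forms of weight `n` to the component `A_n`. -/
noncomputable def restrict (n : ℕ) : grading 𝒜 n →ₗ[K] Module.Dual K (𝒜 n) :=
  LinearMap.lcomp K K (𝒜 n).subtype ∘ₗ toDual ∘ₗ (grading 𝒜 n).subtype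

theorem restrict_injective (n : ℕ) : Function.Injective (restrict 𝒜 n) := by
  refine fun f g hfg => Subtype.ext <| toDual_injective <|
    linearMap_ext_graded (𝒜 := 𝒜) fun k x hx => ?_
  rcases eq_or_ne k n with rfl | hk
  · exact LinearMap.congr_fun hfg ⟨x, hx⟩
  · rw [f.2 k hk x hx, g.2 k hk x hx]

theorem map_eq_grading_of_injective {Φ : A →ₗ[K] GradedDual 𝒜} (hΦ : Function.Injective Φ)
    {n : ℕ} (hn : (𝒜 n).map Φ ≤ grading 𝒜 n) : (𝒜 n).map Φ = grading 𝒜 n := by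
  have : FiniteDimensional K (𝒜 n) := IsGradedHopfAlgebra.finite n
  have : FiniteDimensional K (grading 𝒜 n) := .of_injective _ (restrict_injective n)
  refine Submodule.eq_of_le_of_finrank_le hn ?_
  calc Module.finrank K (grading 𝒜 n)
      ≤ Module.finrank K (Module.Dual K (𝒜 n)) :=
        LinearMap.finrank_le_finrank_of_injective (restrict_injective n)
    _ = Module.finrank K (𝒜 n) := Subspace.dual_finrank_eq
    _ = Module.finrank K ((𝒜 n).map Φ) := (Submodule.equivMapOfInjective Φ hΦ (𝒜 n)).finrank_eq

theorem surjective_of_map_eq_grading {Φ : A →ₗ[K] GradedDual 𝒜}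
    (h : ∀ n, (𝒜 n).map Φ = grading 𝒜 n) : Function.Surjective Φ := by
  rw [← LinearMap.range_eq_top, eq_top_iff, ← iSup_grading]
  exact iSup_le fun n => h n ▸ LinearMap.map_le_range

end GradedDual

section WeightFiltration

open Coalgebra TensorProduct

section Module

variable {K M : Type*} [CommSemiring K] [AddCommMonoid M] [Module K M] {𝒜 : ℕ → Submodule K M}
  {k m n : ℕ}

variable (𝒜) in
/-- The increasing filtration by the weight: the sum of the components of weight less than `n`. -/
def weightLT (n : ℕ) : Submodule K M := ⨆ k < n, 𝒜 k

theorem mem_weightLT (hk : k < n) {x : M} (hx : x ∈ 𝒜 k) : x ∈ weightLT 𝒜 n :=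
  (le_iSup₂_of_le k hk le_rfl : 𝒜 k ≤ weightLT 𝒜 n) hx

theorem weightLT_zero : weightLT 𝒜 0 = ⊥ := by simp [weightLT]

theorem weightLT_mono (h : m ≤ n) : weightLT 𝒜 m ≤ weightLT 𝒜 n :=
  biSup_mono fun _ hk => hk.trans_le h

theorem exists_mem_weightLT (h : ⨆ n, 𝒜 n = ⊤) (x : M) : ∃ n, x ∈ weightLT 𝒜 n := by
  have hx : x ∈ ⨆ n, weightLT 𝒜 n :=
    (iSup_mono' fun k => ⟨k + 1, fun _ => mem_weightLT k.lt_succ_self⟩ :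
      ⨆ n, 𝒜 n ≤ ⨆ n, weightLT 𝒜 n) (h ▸ Submodule.mem_top)
  rwa [Submodule.mem_iSup_of_directed _
    (show Monotone (weightLT 𝒜) from fun _ _ => weightLT_mono).directed_le] at hx

variable (𝒜) in
/-- The filtration of `M ⊗ M` by the weight of the second factor. -/
def rightWeightLT (n : ℕ) : Submodule K (M ⊗[K] M) :=
  Submodule.map₂ (mk K M M) ⊤ (weightLT 𝒜 n)

theorem tmul_mem_rightWeightLT (hk : k < n) (x : M) {y : M} (hy : y ∈ 𝒜 k) :
    x ⊗ₜ y ∈ rightWeightLT 𝒜 n :=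
  Submodule.apply_mem_map₂ (mk K M M) Submodule.mem_top (mem_weightLT hk hy)

theorem rightWeightLT_le {p : Submodule K (M ⊗[K] M)}
    (h : ∀ x, ∀ k < n, ∀ y ∈ 𝒜 k, x ⊗ₜ y ∈ p) : rightWeightLT 𝒜 n ≤ p :=
  Submodule.map₂_le.2 fun x _ =>
    (iSup₂_le fun k hk y hy => h x k hk y hy : weightLT 𝒜 n ≤ p.comap (mk K M M x))

theorem rightWeightLT_zero : rightWeightLT 𝒜 0 = ⊥ :=
  eq_bot_iff.2 <| rightWeightLT_le fun _ k hk => absurd hk k.not_lt_zero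

theorem rightWeightLT_mono (h : m ≤ n) : rightWeightLT 𝒜 m ≤ rightWeightLT 𝒜 n :=
  Submodule.map₂_le_map₂_right (weightLT_mono h)

theorem exists_mem_rightWeightLT (h : ⨆ n, 𝒜 n = ⊤) (z : M ⊗[K] M) :
    ∃ n, z ∈ rightWeightLT 𝒜 n := by
  induction z with
  | zero => exact ⟨0, zero_mem _⟩
  | tmul x y =>
    obtain ⟨n, hn⟩ := exists_mem_weightLT h y
    exact ⟨n, Submodule.apply_mem_map₂ (mk K M M) Submodule.mem_top hn⟩
  | add z w hz hw =>
    obtain ⟨m, hm⟩ := hz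
    obtain ⟨n, hn⟩ := hw
    exact ⟨max m n, add_mem (rightWeightLT_mono (le_max_left m n) hm)
      (rightWeightLT_mono (le_max_right m n) hn)⟩

end Module

section Algebra

variable {K A : Type*} [Field K] [Ring A]

theorem mul_tmul_one_mem_rightWeightLT [Algebra K A] {𝒜 : ℕ → Submodule K A} {n : ℕ}
    {z : A ⊗[K] A} (hz : z ∈ rightWeightLT 𝒜 n) (a : A) :
    z * a ⊗ₜ 1 ∈ rightWeightLT 𝒜 n := by
  suffices h : rightWeightLT 𝒜 n ≤
      (rightWeightLT 𝒜 n).comap (LinearMap.mulRight K (a ⊗ₜ[K] (1 : A))) from h hz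
  refine rightWeightLT_le fun x k hk y hy => ?_
  rw [Submodule.mem_comap, LinearMap.mulRight_apply, Algebra.TensorProduct.tmul_mul_tmul, mul_one]
  exact tmul_mem_rightWeightLT hk _ hy

theorem comul_sub_one_tmul_mem_rightWeightLT [Bialgebra K A] {𝒜 : ℕ → Submodule K A}
    (hconn : ∀ x ∈ 𝒜 0, algebraMap K A (counit (R := K) x) = x)
    (hcounit : ∀ n ≠ 0, ∀ x ∈ 𝒜 n, counit (R := K) x = 0) {n : ℕ} {x : A}
    (hx : comul (R := K) x ∈ tensorGrading 𝒜 n) :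
    comul (R := K) x - 1 ⊗ₜ x ∈ rightWeightLT 𝒜 n := by
  let P : A ⊗[K] A →ₗ[K] A ⊗[K] A := (Algebra.linearMap K A ∘ₗ counit).rTensor A
  have hP : P (comul x) = 1 ⊗ₜ x := by
    rw [LinearMap.rTensor_comp_apply, rTensor_counit_comul, LinearMap.rTensor_tmul,
      Algebra.linearMap_apply, map_one]
  suffices h : tensorGrading 𝒜 n ≤ (rightWeightLT 𝒜 n).comap (LinearMap.id - P) from hP ▸ h hx
  refine Submodule.span_le.2 ?_
  rintro _ ⟨k, l, a, b, hkl, ha, hb, rfl⟩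
  rw [SetLike.mem_coe, Submodule.mem_comap, LinearMap.sub_apply, LinearMap.id_apply,
    LinearMap.rTensor_tmul, LinearMap.comp_apply, Algebra.linearMap_apply]
  rcases eq_or_ne k 0 with rfl | hk
  · rw [hconn a ha, sub_self]
    exact zero_mem _
  · rw [hcounit k hk a ha, map_zero, zero_tmul, sub_zero]
    exact tmul_mem_rightWeightLT (by omega) a hb

variable [HopfAlgebra K A] {𝒜 : ℕ → Submodule K A} {γ : A →ₗ[K] A}

theorem lTensor_mem_rightWeightLT (hγ : GradedDual.IsHomogeneousOfDegree 𝒜 γ (-1)) {n : ℕ}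
    {z : A ⊗[K] A} (hz : z ∈ rightWeightLT 𝒜 (n + 1)) :
    γ.lTensor A z ∈ rightWeightLT 𝒜 n := by
  suffices h : rightWeightLT 𝒜 (n + 1) ≤ (rightWeightLT 𝒜 n).comap (γ.lTensor A) from h hz
  refine rightWeightLT_le fun x k hk y hy => ?_
  rw [Submodule.mem_comap, LinearMap.lTensor_tmul]
  rcases hγ k y hy with ⟨m, hm, hmem⟩ | h0
  · exact tmul_mem_rightWeightLT (by omega) x hmem
  · rw [h0, tmul_zero]
    exact zero_mem _

theorem lTensor_comul_mem_map₂_weightLT (hγ : GradedDual.IsHomogeneousOfDegree 𝒜 γ (-1))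
    (hcomul : ∀ n, ∀ x ∈ 𝒜 n, comul (R := K) x ∈ tensorGrading 𝒜 n) {n : ℕ} {x : A}
    (hx : x ∈ weightLT 𝒜 (n + 1)) :
    γ.lTensor A (comul x) ∈ Submodule.map₂ (mk K A A) (weightLT 𝒜 n) (weightLT 𝒜 n) := by
  suffices h : weightLT 𝒜 (n + 1) ≤ (Submodule.map₂ (mk K A A) (weightLT 𝒜 n)
    (weightLT 𝒜 n)).comap (γ.lTensor A ∘ₗ comul) from h hx
  refine iSup₂_le fun k hk y hy => (Submodule.span_le.2 ?_ :
    tensorGrading 𝒜 k ≤ Submodule.comap (γ.lTensor A) _) (hcomul k y hy)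
  rintro _ ⟨i, j, a, b, hij, ha, hb, rfl⟩
  rw [SetLike.mem_coe, Submodule.mem_comap, LinearMap.lTensor_tmul]
  rcases hγ j b hb with ⟨m, hm, hmem⟩ | h0
  · exact Submodule.apply_mem_map₂ (mk K A A) (mem_weightLT (by omega) ha)
      (mem_weightLT (by omega) hmem)
  · rw [h0, tmul_zero]
    exact zero_mem _

end Algebra

theorem eq_zero_of_map_eq_zero_of_mem_map₂ {K M N : Type*} [Field K] [AddCommGroup M]
    [Module K M] [AddCommGroup N] [Module K N] {f : M →ₗ[K] N} {p : Submodule K M}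
    (hf : ∀ x ∈ p, f x = 0 → x = 0) {z : M ⊗[K] M} (hz : z ∈ Submodule.map₂ (mk K M M) p p)
    (h : map f f z = 0) : z = 0 := by
  rw [← range_mapIncl] at hz
  obtain ⟨w, rfl⟩ := hz
  have hinj : Function.Injective (f ∘ₗ p.subtype) := (injective_iff_map_eq_zero _).2 fun x hx =>
    Subtype.ext (hf x x.2 hx)
  have hw : map (f ∘ₗ p.subtype) (f ∘ₗ p.subtype) w = 0 := by rw [map_comp]; exact h
  rw [(map_eq_zero_iff _ (map_injective_of_flat_flat _ _ hinj hinj)).1 hw, map_zero]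

end WeightFiltration

namespace HPR

open PTree Coalgebra GradedDual

variable {D : Type*}

theorem linearMap_ext_forest {M : Type*} [AddCommMonoid M] [Module ℚ M] {f g : HPR D →ₗ[ℚ] M}
    (h : ∀ F, f (forest F) = g (forest F)) : f = g :=
  (forestBasis D).ext fun F => by rw [forestBasis_apply, h]

theorem linearMap_ext_mul_graft {M : Type*} [AddCommMonoid M] [Module ℚ M] {f g : HPR D →ₗ[ℚ] M}
    (h_one : f 1 = g 1) (h_graft : ∀ d x y, f (y * graft d x) = g (y * graft d x)) : f = g := by
  refine linearMap_ext_forest fun F => ?_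
  rcases List.eq_nil_or_concat F with rfl | ⟨G, ⟨d, H⟩, rfl⟩
  · exact h_one
  · rw [List.concat_eq_append, forest_append, forest_cons, forest_nil, mul_one, ← graft_forest]
    exact h_graft d _ _

theorem isHochschildCocycle_graft (d : D) : IsHochschildCocycle (R := ℚ) (graft d) :=
  comulHom_graft d

open Classical in
theorem gamma_forest_concat (d : D) (F : List (PTree D)) (t : PTree D) :
    gamma d (forest (F ++ [t])) = if t = node d [] then forest F else 0 := by
  rw [gamma_forest]
  simp only [List.getLast?_append, List.getLast?_singleton, List.dropLast_concat, Option.some_or,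
    Option.some.injEq]

theorem gamma_one (d : D) : gamma d (1 : HPR D) = 0 := by
  classical
  rw [← forest_nil, gamma_forest, List.getLast?_nil, if_neg (Option.some_ne_none _).symm]

theorem isCounitDerivation_gamma (d : D) : IsCounitDerivation (R := ℚ) (gamma d) := by
  classical
  have h : (LinearMap.mul ℚ (HPR D)).compr₂ (gamma d) =
      (LinearMap.lsmul ℚ (HPR D)).flip.compl₁₂ (gamma d) (counitHom D).toLinearMap +
        (LinearMap.mul ℚ (HPR D)).compl₂ (gamma d) := by
    refine linearMap_ext_forest fun F => linearMap_ext_forest fun G => ?_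
    change gamma d (forest F * forest G) =
      counitHom D (forest G) • gamma d (forest F) + forest F * gamma d (forest G)
    rcases List.eq_nil_or_concat G with rfl | ⟨G, t, rfl⟩
    · rw [forest_nil, mul_one, map_one, one_smul, gamma_one, mul_zero, add_zero]
    · have hcounit : counitHom D (forest (G ++ [t])) = 0 := by simp
      rw [List.concat_eq_append, hcounit, ← forest_append, ← List.append_assoc,
        gamma_forest_concat, gamma_forest_concat, zero_smul, zero_add, mul_ite, mul_zero,
        forest_append]
  exact LinearMap.congr_fun₂ h

theorem gamma_mul_graft [DecidableEq D] (d e : D) (x y : HPR D) :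
    gamma d (y * graft e x) = if e = d then counit (R := ℚ) x • y else 0 := by
  classical
  have h : gamma d ∘ₗ LinearMap.mulLeft ℚ y ∘ₗ graft e =
      if e = d then (counitHom D).toLinearMap.smulRight y else 0 := by
    refine linearMap_ext_forest fun F => ?_
    rw [LinearMap.comp_apply, LinearMap.comp_apply, LinearMap.mulLeft_apply,
      isCounitDerivation_gamma d, counit_eq, counitHom_graft, zero_smul, zero_add, graft_forest,
      ← mul_one (tree _), ← forest_nil, ← forest_cons, ← List.nil_append [_], gamma_forest_concat]
    rcases F with _ | ⟨t, F⟩ <;> by_cases hed : e = d <;> simp [hed]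
  exact (LinearMap.congr_fun h x).trans (by split_ifs <;> rfl)

section Lift

variable {B : Type*} [Semiring B] [Algebra ℚ B] (L : D → B →ₗ[ℚ] B)

mutual

/-- The image of a tree under `HPR.lift L`. -/
def liftTree : PTree D → B
  | node d F => L d (liftForest F)

/-- The image of a forest under `HPR.lift L`. -/
def liftForest : List (PTree D) → B
  | [] => 1
  | t :: F => liftTree t * liftForest F

end

/-- The universal property of `H`: the algebra morphism that turns the grafting operators into
given linear maps `L d`. -/
noncomputable def lift : HPR D →ₐ[ℚ] B := FreeAlgebra.lift ℚ (liftTree L)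

theorem lift_tree (t : PTree D) : lift L (tree t) = liftTree L t := FreeAlgebra.lift_ι_apply _ _

theorem lift_forest (F : List (PTree D)) : lift L (forest F) = liftForest L F := by
  induction F with
  | nil => rw [forest_nil, map_one, liftForest]
  | cons t F ih => rw [forest_cons, map_mul, ih, lift_tree, liftForest]

theorem lift_graft (d : D) (x : HPR D) : lift L (graft d x) = L d (lift L x) := by
  have h : (lift L).toLinearMap ∘ₗ graft d = L d ∘ₗ (lift L).toLinearMap :=
    linearMap_ext_forest fun F => by
      simp only [LinearMap.comp_apply, AlgHom.toLinearMap_apply]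
      rw [graft_forest, lift_tree, liftTree, lift_forest]
  exact LinearMap.congr_fun h x

variable {L}

theorem lift_forest_mem {ℬ : ℕ → Submodule ℚ B} [SetLike.GradedMonoid ℬ] {F : List (PTree D)}
    (hF : ∀ t ∈ F, lift L (tree t) ∈ ℬ (weight t)) : lift L (forest F) ∈ ℬ (weightForest F) := by
  induction F with
  | nil =>
    rw [forest_nil, map_one, weightForest]
    exact SetLike.GradedOne.one_mem
  | cons t F ih =>
    rw [forest_cons, map_mul, weightForest]
    exact SetLike.GradedMul.mul_mem (hF t List.mem_cons_self)
      (ih fun s hs => hF s (List.mem_cons_of_mem t hs))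

theorem map_lift_le {ℬ : ℕ → Submodule ℚ B} [SetLike.GradedMonoid ℬ]
    (hL : ∀ d n, ∀ b ∈ ℬ n, L d b ∈ ℬ (n + 1)) (n : ℕ) :
    (weightGrading D n).map (lift L).toLinearMap ≤ ℬ n := by
  have htree : ∀ t : PTree D, lift L (tree t) ∈ ℬ (weight t) :=
    PTree.induction fun d F hF => by
      rw [← graft_forest, lift_graft, weight]
      exact hL d _ _ (lift_forest_mem hF)
  refine Submodule.map_le_iff_le_comap.2 (Submodule.span_le.2 ?_)
  rintro _ ⟨F, rfl, rfl⟩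
  exact lift_forest_mem fun t _ => htree t

end Lift

/-- The morphism `HPR.lift L` for Hochschild `1`-cocycles `L d`, as a morphism of bialgebras. -/
noncomputable def liftBialgHom {B : Type*} [Ring B] [Bialgebra ℚ B] (L : D → B →ₗ[ℚ] B)
    (hL : ∀ d, IsHochschildCocycle (L d)) : HPR D →ₐc[ℚ] B :=
  BialgHom.ofAlgHom (lift L)
    (algHom_ext_graft fun d x _ => by
      change counit (lift L (graft d x)) = counitHom D (graft d x)
      rw [lift_graft, (hL d).counit_apply, counitHom_graft])
    (algHom_ext_graft fun d x hx => by
      change Algebra.TensorProduct.map (lift L) (lift L) (comulHom D x) = comul (lift L x) at hx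
      change Algebra.TensorProduct.map (lift L) (lift L) (comulHom D (graft d x)) =
        comul (lift L (graft d x))
      have hgraft : ∀ z : HPR D ⊗[ℚ] HPR D,
          Algebra.TensorProduct.map (lift L) (lift L) ((graft d).lTensor _ z) =
            (L d).lTensor _ (Algebra.TensorProduct.map (lift L) (lift L) z) := fun z => by
        induction z with
        | zero => simp only [map_zero]
        | tmul a b => simp only [LinearMap.lTensor_tmul, Algebra.TensorProduct.map_tmul, lift_graft]
        | add z w hz hw => simp only [map_add, hz, hw]
      rw [lift_graft, hL d, comulHom_graft, map_add, hgraft, hx, Algebra.TensorProduct.map_tmul,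
        map_one, lift_graft])

theorem liftBialgHom_graft {B : Type*} [Ring B] [Bialgebra ℚ B] {L : D → B →ₗ[ℚ] B}
    (hL : ∀ d, IsHochschildCocycle (L d)) (d : D) (x : HPR D) :
    liftBialgHom L hL (graft d x) = L d (liftBialgHom L hL x) :=
  lift_graft L d x

theorem bialgHom_ext_graft {B : Type*} [Semiring B] [Bialgebra ℚ B] {L : D → B →ₗ[ℚ] B}
    {f g : HPR D →ₐc[ℚ] B} (hf : ∀ d x, f (graft d x) = L d (f x))
    (hg : ∀ d x, g (graft d x) = L d (g x)) : f = g := by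
  have h : (f : HPR D →ₐ[ℚ] B) = (g : HPR D →ₐ[ℚ] B) := algHom_ext_graft fun d x hx =>
    (hf d x).trans ((congrArg (L d) hx).trans (hg d x).symm)
  exact DFunLike.ext f g (AlgHom.congr_fun h)

section Cogamma

open TensorProduct

/-- The map `(id ⊗ γ_d) ∘ Δ`, transpose of `f ⊗ g ↦ f γ_d^{*g}(g)`. -/
noncomputable def cogamma (d : D) : HPR D →ₗ[ℚ] HPR D ⊗[ℚ] HPR D :=
  (gamma d).lTensor (HPR D) ∘ₗ comul

theorem cogamma_apply (d : D) (x : HPR D) :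
    cogamma d x = (gamma d).lTensor (HPR D) (comul (R := ℚ) x) := rfl

theorem lTensor_gamma_mul_tmul_one (d : D) (z : HPR D ⊗[ℚ] HPR D) (a : HPR D) :
    (gamma d).lTensor (HPR D) (z * a ⊗ₜ 1) = (gamma d).lTensor (HPR D) z * a ⊗ₜ 1 := by
  induction z with
  | zero => simp only [zero_mul, map_zero]
  | tmul x y => simp only [Algebra.TensorProduct.tmul_mul_tmul, LinearMap.lTensor_tmul, mul_one]
  | add z w hz hw => simp only [add_mul, map_add, hz, hw]

theorem lTensor_gamma_mul_lTensor_graft_comul [DecidableEq D] (d e : D) (z : HPR D ⊗[ℚ] HPR D)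
    (x : HPR D) : (gamma d).lTensor (HPR D) (z * (graft e).lTensor (HPR D) (comul (R := ℚ) x)) =
      if e = d then z * x ⊗ₜ 1 else 0 := by
  have h : ∀ w : HPR D ⊗[ℚ] HPR D, (gamma d).lTensor (HPR D) (z * (graft e).lTensor (HPR D) w) =
      if e = d then z * (Algebra.linearMap ℚ (HPR D) ∘ₗ counit).lTensor (HPR D) w else 0 := by
    intro w
    induction w with
    | zero => simp only [map_zero, mul_zero, ite_self]
    | add v w hv hw => simp only [map_add, mul_add, hv, hw]; split_ifs <;> simp
    | tmul a b =>
      induction z with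
      | zero => simp only [zero_mul, map_zero, ite_self]
      | add v w hv hw => simp only [map_add, add_mul, hv, hw]; split_ifs <;> simp
      | tmul p q =>
        simp only [LinearMap.lTensor_tmul, Algebra.TensorProduct.tmul_mul_tmul, gamma_mul_graft,
          LinearMap.comp_apply, Algebra.linearMap_apply]
        split_ifs
        · rw [Algebra.algebraMap_eq_smul_one, mul_smul_comm, mul_one]
        · rw [tmul_zero]
  rw [h, LinearMap.lTensor_comp_apply, lTensor_counit_comul, LinearMap.lTensor_tmul,
    Algebra.linearMap_apply, map_one]

theorem cogamma_mul_graft [DecidableEq D] (d e : D) (x y : HPR D) :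
    cogamma d (y * graft e x) =
      cogamma d y * graft e x ⊗ₜ 1 + if e = d then comul y * x ⊗ₜ 1 else 0 := by
  rw [cogamma_apply, Bialgebra.comul_mul, isHochschildCocycle_graft e, mul_add, map_add,
    lTensor_gamma_mul_tmul_one, lTensor_gamma_mul_lTensor_graft_comul, cogamma_apply]

/-- The linear map `x ⊗ y ↦ y B_d^+(x)`. -/
noncomputable def mulGraft (d : D) : HPR D ⊗[ℚ] HPR D →ₗ[ℚ] HPR D :=
  TensorProduct.lift ((LinearMap.mul ℚ (HPR D)).flip ∘ₗ graft d)

theorem mulGraft_tmul (d : D) (x y : HPR D) : mulGraft d (x ⊗ₜ y) = y * graft d x := rfl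

/-- The linear map `(x_d ⊗ y_d)_d ↦ ∑_d y_d B_d^+(x_d)` onto the augmentation ideal; up to terms of
smaller weight in the second factor, it is inverted by the family of the maps `cogamma d`. -/
noncomputable def sumMulGraft (D : Type*) : (D →₀ HPR D ⊗[ℚ] HPR D) →ₗ[ℚ] HPR D :=
  Finsupp.lsum ℚ mulGraft

theorem sumMulGraft_single (d : D) (z : HPR D ⊗[ℚ] HPR D) :
    sumMulGraft D (Finsupp.single d z) = mulGraft d z := by
  rw [sumMulGraft, Finsupp.lsum_single]

theorem sub_counit_smul_one_mem_range_sumMulGraft (x : HPR D) :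
    x - counit (R := ℚ) x • 1 ∈ LinearMap.range (sumMulGraft D) := by
  let Q := (LinearMap.range (sumMulGraft D)).mkQ
  have h : Q ∘ₗ (LinearMap.id - (counitHom D).toLinearMap.smulRight 1) = 0 := by
    refine linearMap_ext_mul_graft ?_ fun d x y => ?_
    · simp
    · simp only [Q, LinearMap.comp_apply, LinearMap.sub_apply, LinearMap.id_apply,
        LinearMap.smulRight_apply, AlgHom.toLinearMap_apply, map_mul, counitHom_graft, mul_zero,
        zero_smul, sub_zero, LinearMap.zero_apply, Submodule.mkQ_apply,
        Submodule.Quotient.mk_eq_zero]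
      exact ⟨Finsupp.single d (x ⊗ₜ y), by rw [sumMulGraft_single, mulGraft_tmul]⟩
  exact (Submodule.Quotient.mk_eq_zero _).1 (LinearMap.congr_fun h x)

theorem cogamma_mul_graft_sub_mem [DecidableEq D] (d e : D) {k n : ℕ} (hk : k ≤ n)
    {y : HPR D} (hy : y ∈ weightGrading D k) (x : HPR D) :
    cogamma d (y * graft e x) - (if e = d then x ⊗ₜ y else 0) ∈
      rightWeightLT (weightGrading D) n := by
  have hcomul : comul (R := ℚ) y - 1 ⊗ₜ y ∈ rightWeightLT (weightGrading D) n :=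
    rightWeightLT_mono hk <| comul_sub_one_tmul_mem_rightWeightLT
      algebraMap_counit counit_eq_zero (comul_mem k y hy)
  have hcogamma : cogamma d y ∈ rightWeightLT (weightGrading D) n := by
    refine lTensor_mem_rightWeightLT (gamma_homogeneous d) ?_
    rw [← sub_add_cancel (comul y) (1 ⊗ₜ[ℚ] y)]
    exact add_mem (rightWeightLT_mono n.le_succ hcomul)
      (tmul_mem_rightWeightLT (Nat.lt_succ_of_le hk) 1 hy)
  have hy_mul : comul (R := ℚ) y * x ⊗ₜ 1 - x ⊗ₜ y = (comul (R := ℚ) y - 1 ⊗ₜ y) * x ⊗ₜ 1 := by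
    rw [sub_mul, Algebra.TensorProduct.tmul_mul_tmul, one_mul, mul_one]
  rw [cogamma_mul_graft, add_sub_assoc]
  refine add_mem (mul_tmul_one_mem_rightWeightLT hcogamma _) ?_
  split_ifs
  · rw [hy_mul]
    exact mul_tmul_one_mem_rightWeightLT hcomul x
  · rw [sub_zero]
    exact zero_mem _

theorem cogamma_sumMulGraft_sub_mem (d : D) {n : ℕ} {z : D →₀ HPR D ⊗[ℚ] HPR D}
    (hz : ∀ e, z e ∈ rightWeightLT (weightGrading D) (n + 1)) :
    cogamma d (sumMulGraft D z) - z d ∈ rightWeightLT (weightGrading D) n := by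
  classical
  let T := cogamma d ∘ₗ sumMulGraft D - Finsupp.lapply d
  have hsingle : ∀ e, rightWeightLT (weightGrading D) (n + 1) ≤
      (rightWeightLT (weightGrading D) n).comap (T ∘ₗ Finsupp.lsingle e) := fun e =>
    rightWeightLT_le fun x k hk y hy => by
      have hT : T (Finsupp.single e (x ⊗ₜ y)) =
          cogamma d (y * graft e x) - if e = d then x ⊗ₜ y else 0 := by
        simp only [T, LinearMap.sub_apply, LinearMap.comp_apply, Finsupp.lapply_apply,
          Finsupp.single_apply, sumMulGraft_single, mulGraft_tmul]
      rw [Submodule.mem_comap, LinearMap.comp_apply, Finsupp.lsingle_apply, hT]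
      exact cogamma_mul_graft_sub_mem d e (Nat.le_of_lt_succ hk) hy x
  change T z ∈ _
  rw [← z.sum_single, map_finsuppSum]
  exact Submodule.sum_mem _ fun e _ => hsingle e (hz e)

theorem eq_zero_of_cogamma_sumMulGraft_eq_zero {z : D →₀ HPR D ⊗[ℚ] HPR D}
    (h : ∀ d, cogamma d (sumMulGraft D z) = 0) : z = 0 := by
  have hdescent : ∀ n, (∀ d, z d ∈ rightWeightLT (weightGrading D) n) → z = 0 := fun n hz => by
    induction n with
    | zero =>
      refine Finsupp.ext fun d => ?_
      simpa only [rightWeightLT_zero, Submodule.mem_bot, Finsupp.zero_apply] using hz d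
    | succ n ih =>
      refine ih fun d => ?_
      simpa only [h, zero_sub, neg_mem_iff] using cogamma_sumMulGraft_sub_mem d hz
  choose n hn using exists_mem_rightWeightLT
    (DirectSum.Decomposition.isInternal (weightGrading D)).submodule_iSup_eq_top
  refine hdescent (z.support.sup fun d => n (z d)) fun d => ?_
  by_cases hd : d ∈ z.support
  · exact rightWeightLT_mono (Finset.le_sup (f := fun d => n (z d)) hd) (hn (z d))
  · rw [Finsupp.notMem_support_iff.1 hd]
    exact zero_mem _

theorem eq_zero_of_cogamma_eq_zero {x : HPR D} (hcounit : counit (R := ℚ) x = 0)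
    (h : ∀ d, cogamma d x = 0) : x = 0 := by
  obtain ⟨z, rfl⟩ : x ∈ LinearMap.range (sumMulGraft D) := by
    simpa only [hcounit, zero_smul, sub_zero] using sub_counit_smul_one_mem_range_sumMulGraft x
  rw [eq_zero_of_cogamma_sumMulGraft_eq_zero h, map_zero]

theorem injective_of_semiconj_gamma {B : Type*} [AddCommGroup B] [Module ℚ B] [Coalgebra ℚ B]
    (f : HPR D →ₗc[ℚ] B) (L : D → B →ₗ[ℚ] B) (hf : ∀ d x, f (gamma d x) = L d (f x)) :
    Function.Injective f := by
  have hcogamma : ∀ d x, map f.toLinearMap f.toLinearMap (cogamma d x) =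
      (L d).lTensor B (comul (R := ℚ) (f x)) := fun d x => by
    have hcomp : f.toLinearMap ∘ₗ gamma d = L d ∘ₗ f.toLinearMap := LinearMap.ext (hf d)
    rw [← CoalgHomClass.map_comp_comul_apply f x, cogamma_apply, ← LinearMap.comp_apply,
      LinearMap.map_comp_lTensor, hcomp, ← LinearMap.lTensor_comp_map]
    rfl
  have hweight : ∀ n, ∀ x ∈ weightLT (weightGrading D) n, f x = 0 → x = 0 := fun n => by
    induction n with
    | zero => exact fun x hx _ => by simpa only [weightLT_zero, Submodule.mem_bot] using hx
    | succ n ih =>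
      intro x hx hfx
      refine eq_zero_of_cogamma_eq_zero ?_ fun d => ?_
      · rw [← CoalgHomClass.counit_comp_apply f x, hfx, map_zero]
      · refine eq_zero_of_map_eq_zero_of_mem_map₂ (f := f.toLinearMap) ih
          (lTensor_comul_mem_map₂_weightLT (gamma_homogeneous d) comul_mem hx) ?_
        exact (hcogamma d x).trans (by rw [hfx, map_zero, map_zero])
  refine (injective_iff_map_eq_zero f).2 fun x hx => ?_
  obtain ⟨n, hn⟩ := exists_mem_weightLT
    (DirectSum.Decomposition.isInternal (weightGrading D)).submodule_iSup_eq_top x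
  exact hweight n x hn hx

end Cogamma

theorem graft_homogeneous (d : D) : IsHomogeneousOfDegree (weightGrading D) (graft d) 1 := by
  intro n x hx
  refine .inl ⟨n + 1, by norm_cast, ?_⟩
  suffices h : weightGrading D n ≤ (weightGrading D (n + 1)).comap (graft d) from h hx
  refine Submodule.span_le.2 ?_
  rintro _ ⟨F, rfl, rfl⟩
  rw [SetLike.mem_coe, Submodule.mem_comap, graft_forest]
  exact tree_mem (node d F)

section Psi

variable [Finite D]

theorem isHochschildCocycle_gammaDual (d : D) : IsHochschildCocycle (gammaDual d) :=
  isHochschildCocycle_transpose _ (isCounitDerivation_gamma d)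

/-- The transpose of the grafting operator `B_d^+` on the graded dual. -/
noncomputable def graftDual (d : D) :
    GradedDual (weightGrading D) →ₗ[ℚ] GradedDual (weightGrading D) :=
  transpose (graft d) (graft_homogeneous d)

theorem graftDual_mul_gammaDual [DecidableEq D] (d e : D) (f g : GradedDual (weightGrading D)) :
    graftDual d (g * gammaDual e f) = if e = d then counit (R := ℚ) f • g else 0 := by
  have hgamma : graftDual d (gammaDual e f) = if e = d then counit (R := ℚ) f • 1 else 0 := by
    refine toDual_injective (LinearMap.ext fun x => ?_)
    have hcounit : counit (R := ℚ) f = toDual f 1 := rfl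
    rw [graftDual, gammaDual, toDual_transpose, toDual_transpose, ← one_mul (graft d x),
      gamma_mul_graft, hcounit]
    by_cases hed : e = d
    · rw [if_pos hed.symm, if_pos hed, map_smul, map_smul, LinearMap.smul_apply,
        GradedDual.toDual_one, smul_eq_mul, smul_eq_mul, mul_comm]
    · rw [if_neg (Ne.symm hed), if_neg hed, map_zero, map_zero, LinearMap.zero_apply]
  rw [graftDual, isCounitDerivation_transpose _ (isHochschildCocycle_graft d), ← graftDual, hgamma,
    (isHochschildCocycle_gammaDual e).counit_apply, zero_smul, zero_add, mul_ite, mul_zero,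
    mul_smul_comm, mul_one]

/-- The morphism of bialgebras `Ψ` with `Ψ ∘ B_d^+ = γ_d^{*g} ∘ Ψ`. -/
noncomputable def psi (D : Type*) [Finite D] : HPR D →ₐc[ℚ] GradedDual (weightGrading D) :=
  liftBialgHom gammaDual isHochschildCocycle_gammaDual

theorem psi_graft (d : D) (x : HPR D) : psi D (graft d x) = gammaDual d (psi D x) :=
  liftBialgHom_graft isHochschildCocycle_gammaDual d x

theorem psi_gamma (d : D) (x : HPR D) : psi D (gamma d x) = graftDual d (psi D x) := by
  classical
  have h : (psi D : HPR D →ₗ[ℚ] _) ∘ₗ gamma d = graftDual d ∘ₗ (psi D : HPR D →ₗ[ℚ] _) := by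
    refine linearMap_ext_mul_graft ?_ fun e x y => ?_
    · change psi D (gamma d 1) = graftDual d (psi D 1)
      rw [gamma_one, map_zero, map_one, graftDual,
        (isCounitDerivation_transpose _ (isHochschildCocycle_graft d)).apply_one]
    · change psi D (gamma d (y * graft e x)) = graftDual d (psi D (y * graft e x))
      rw [gamma_mul_graft, map_mul, psi_graft, graftDual_mul_gammaDual,
        CoalgHomClass.counit_comp_apply]
      split_ifs
      · rw [map_smul]
      · rw [map_zero]
  exact LinearMap.congr_fun h x

theorem psi_injective : Function.Injective (psi D) :=
  injective_of_semiconj_gamma (psi D : HPR D →ₗc[ℚ] GradedDual (weightGrading D)) graftDual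
    psi_gamma

theorem map_psi (n : ℕ) : (weightGrading D n).map (psi D : HPR D →ₗ[ℚ] _) =
    grading (weightGrading D) n :=
  map_eq_grading_of_injective psi_injective <|
    map_lift_le (ℬ := grading (weightGrading D))
      (fun d _ _ => transpose_mem_grading (gamma_homogeneous d) (by push_cast; ring)) n

theorem psi_surjective : Function.Surjective (psi D) :=
  surjective_of_map_eq_grading map_psi

end Psi

end HPR

theorem mainTheorem3 (D : Type*) [Finite D] :
    ∃ Ψ : HPR D ≃ₐc[ℚ] GradedDual (HPR.weightGrading D),
      (∀ (d : D) (x : HPR D), Ψ (HPR.graft d x) = HPR.gammaDual d (Ψ x)) ∧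
      (∀ x : HPR D, Ψ (HopfAlgebra.antipode ℚ x) = HopfAlgebra.antipode ℚ (Ψ x)) ∧
      (∀ n : ℕ, (HPR.weightGrading D n).map (Ψ : HPR D →ₗ[ℚ] GradedDual (HPR.weightGrading D)) =
        GradedDual.grading (HPR.weightGrading D) n) ∧
      ∀ Φ : HPR D →ₐc[ℚ] GradedDual (HPR.weightGrading D),
        (∀ (d : D) (x : HPR D), Φ (HPR.graft d x) = HPR.gammaDual d (Φ x)) →
          ∀ x : HPR D, Φ x = Ψ x := by
  refine ⟨BialgEquiv.ofBijective (HPR.psi D) ⟨HPR.psi_injective, HPR.psi_surjective⟩,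
    HPR.psi_graft, bialgHom_map_antipode (HPR.psi D), HPR.map_psi, fun Φ hΦ x => ?_⟩
  exact DFunLike.congr_fun (HPR.bialgHom_ext_graft hΦ HPR.psi_graft) x
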